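/- Let $(R,\mathfrak m,k)$ be an equicharacteristic (i.e. $\operatorname{char} R=\operatorname{char} k$) Cohen–Macaulay Noetherian local ring of dimension $d$ with infinite residue field $k$, and let $I$ be an $\mathfrak m$-primary ideal of $R$. An ideal $J\subseteq I$ is a reduction of $I$ if $I^{r+1}=JI^r$ for some $r\ge 0$, and a minimal reduction if it is minimal under inclusion among the reductions of $I$. For a minimal reduction $H$ of $I$, say that $I$ is stretched with respect to $H$ if $$H\cap I^2=HI\qquad\text{and}\qquad \lambda\big((I/H)^2/(I/H)^3\big)\le 1,$$ where $I/H$ is regarded as an ideal of $R/H$ and $\lambda$ denotes length. Suppose that $I$ is stretched with respect to some minimal reduction $H$. Then $I$ is stretched with respect to every general minimal reduction. That is: for any generators $I=(a_1,\dots,a_s)$ there is a Zariski dense open subset $U\subseteq k^{ds}$ such that, for every matrix $(\lambda_{ij})\in R^{ds}$ whose image in $k^{ds}$ lies in $U$, the ideal $J=(x_1,\dots,x_d)$ with $x_i=\sum_{j=1}^s\lambda_{ij}a_j$ is a minimal reduction of $I$, and $I$ is stretched with respect to $J$. -/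

import Mathlib

/-- A ring of equal characteristic: a local ring with the same characteristic as its
residue field. -/
def IsEquicharacteristic (R : Type*) [CommRing R] [IsLocalRing R] : Prop :=
  ringChar R = ringChar (IsLocalRing.ResidueField R)

/-- A local ring `R` is Cohen-Macaulay if its depth equals its dimension, i.e. its maximal ideal
contains an `R`-regular sequence of length `dim R` (for Noetherian local rings, which are the only
rings this is used for). -/
def IsCohenMacaulayLocal (R : Type*) [CommRing R] [IsLocalRing R] : Prop :=
  ∃ rs : List R, (∀ r ∈ rs, r ∈ IsLocalRing.maximalIdeal R) ∧
    RingTheory.Sequence.IsRegular R rs ∧ ((rs.length : ℕ) : WithBot ℕ∞) = ringKrullDim R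

namespace Ideal

/-- `I` is primary to the maximal ideal of the local ring `R`. -/
def IsPrimaryToMaximal {R : Type*} [CommRing R] [IsLocalRing R] (I : Ideal R) : Prop :=
  I.IsPrimary ∧ I.radical = IsLocalRing.maximalIdeal R

/-- `J` is a reduction of `I`: `J ⊆ I` and `I ^ (r + 1) = J I ^ r` for some `r ≥ 0`. -/
def IsReductionOf {R : Type*} [CommRing R] (J I : Ideal R) : Prop :=
  J ≤ I ∧ ∃ r : ℕ, I ^ (r + 1) = J * I ^ r

/-- `J` is a reduction of `I`, minimal with respect to inclusion. -/
def IsMinimalReductionOf {R : Type*} [CommRing R] (J I : Ideal R) : Prop :=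
  Minimal (fun L : Ideal R => L.IsReductionOf I) J

/-- The Hilbert function of an ideal `I` of `R`: `n ↦ λ(I ^ n / I ^ (n + 1))`, with values in
`ℕ∞` (`λ` is the length of an `R`-module). -/
noncomputable def hilbertFunction {R : Type*} [CommRing R] (I : Ideal R) (n : ℕ) : ℕ∞ :=
  Module.length R (↥(I ^ n) ⧸ Submodule.submoduleOf (I ^ (n + 1)) (I ^ n))

/-- `I` is stretched with respect to `H`: the ideal `H` is a minimal reduction of `I`,
`H ∩ I ^ 2 = H I`, and the ideal `I / H` of `R / H` has Hilbert function at most `1` in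
degree `2`. -/
def IsStretchedWith {R : Type*} [CommRing R] (I H : Ideal R) : Prop :=
  H.IsMinimalReductionOf I ∧ H ⊓ I ^ 2 = H * I ∧
    (I.map (Ideal.Quotient.mk H)).hilbertFunction 2 ≤ 1

end Ideal

/-- The Zariski topology on the affine space `k ^ σ` (the set of `k`-rational points), generated
by the principal open sets `{x | p x ≠ 0}`. -/
abbrev zariskiTopology (σ k : Type*) [Field k] : TopologicalSpace (σ → k) :=
  TopologicalSpace.generateFrom
    {U | ∃ p : MvPolynomial σ k, U = {x : σ → k | MvPolynomial.eval x p ≠ 0}}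

/-- `U` is a dense open subset of `k ^ σ` for the Zariski topology. -/
def IsZariskiDenseOpen {σ k : Type*} [Field k] (U : Set (σ → k)) : Prop :=
  @IsOpen (σ → k) (zariskiTopology σ k) U ∧ @Dense (σ → k) (zariskiTopology σ k) U

/-- The ideal generated by the `d` elements `x i = ∑ j, c i j * a j`. -/
def idealOfCombinations {R : Type*} [CommRing R] {d s : ℕ} (c : Fin d → Fin s → R)
    (a : Fin s → R) : Ideal R :=
  Ideal.span (Set.range fun i : Fin d => ∑ j : Fin s, c i j * a j)

/-! The ideals `idealOfCombinations c a` form a family over affine space, and `H` is the member at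
some point `c₀`. Being stretched is made to follow from three conditions, each holding at `c₀` and
each guaranteed by the nonvanishing of some nonzero polynomial over the residue field. The product
of the three polynomials defines `U`.

Write `J` for the member at `c` and `𝔪` for the maximal ideal. (1) `I ^ (r + 1) ≤ J * I ^ r`: open
by Nakayama over `R[Z]` at the point `c₀`. A reduction with `dim R` generators is minimal. (2) If `∑
i, r i * x i ∈ I ^ 2` then all `r i ∈ I`, which gives `J ⊓ I ^ 2 = J * I`. It says that a map
`(R/I)^d → R/I²` is injective; this can be tested on socles, where it becomes the nonvanishing of a
determinant. At `c₀` it follows from `H ⊓ I ^ 2 = H * I`, because in a Cohen-Macaulay ring relations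
among parameters have coefficients in the parameter ideal. (3) `I² / (I³ + J I)` is cyclic and
killed by `𝔪`. Cyclicity spreads by Nakayama; annihilation by `𝔪` needs the dichotomy in
`exists_mul_map_C_maximalIdeal_mul_le`.

To place `H` in the family, it must have `d = dim R` generators. With more, the growth of the length
of `R / H ^ n` makes them analytically dependent, and over an infinite residue field one generator
can be eliminated up to reduction, against minimality. -/

/-! ### Principal open sets in the Zariski topology -/

section Zariski

variable {σ k : Type*} [Field k]

theorem exists_eval_ne_zero_of_isOpen_zariskiTopology {O : Set (σ → k)}
    (hO : @IsOpen (σ → k) (zariskiTopology σ k) O) {x : σ → k} (hx : x ∈ O) :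
    ∃ p : MvPolynomial σ k, MvPolynomial.eval x p ≠ 0 ∧
      ∀ y, MvPolynomial.eval y p ≠ 0 → y ∈ O := by
  induction hO with
  | basic U hU =>
    obtain ⟨p, rfl⟩ := hU
    exact ⟨p, hx, fun _ h => h⟩
  | univ => exact ⟨1, by simp, fun _ _ => trivial⟩
  | inter U V _ _ ihU ihV =>
    obtain ⟨p, hp, hpU⟩ := ihU hx.1
    obtain ⟨q, hq, hqV⟩ := ihV hx.2
    refine ⟨p * q, by simp [hp, hq], fun y hy => ?_⟩
    rw [map_mul] at hy
    exact ⟨hpU y (left_ne_zero_of_mul hy), hqV y (right_ne_zero_of_mul hy)⟩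
  | sUnion S _ ih =>
    obtain ⟨U, hU, hxU⟩ := hx
    obtain ⟨p, hp, hpU⟩ := ih U hU hxU
    exact ⟨p, hp, fun y hy => ⟨U, hU, hpU y hy⟩⟩

/-- Every nonempty open set contains a nonempty principal one, and over an infinite field a product
of two nonzero polynomials has a nonzero value. -/
theorem isZariskiDenseOpen_setOf_eval_ne_zero [Infinite k] {f : MvPolynomial σ k} (hf : f ≠ 0) :
    IsZariskiDenseOpen {x : σ → k | MvPolynomial.eval x f ≠ 0} := by
  let _ := zariskiTopology σ k
  refine ⟨TopologicalSpace.isOpen_generateFrom_of_mem ⟨f, rfl⟩, ?_⟩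
  refine dense_iff_inter_open.2 fun O hO ⟨x, hx⟩ => ?_
  obtain ⟨p, hp, hpO⟩ := exists_eval_ne_zero_of_isOpen_zariskiTopology hO hx
  have hp0 : p ≠ 0 := by
    rintro rfl
    simp at hp
  by_contra hne
  refine mul_ne_zero hp0 hf (MvPolynomial.funext fun y => ?_)
  by_contra hy
  rw [map_zero, map_mul] at hy
  exact hne ⟨y, hpO y (left_ne_zero_of_mul hy), right_ne_zero_of_mul hy⟩

end Zariski

/-! ### Spreading conditions out from a point, over the polynomial ring -/

section PolynomialFamily

open IsLocalRing MvPolynomial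

variable {R σ : Type*} [CommRing R]

theorem map_C_mul_le_iff {𝔞 : Ideal R} {P K : Ideal (MvPolynomial σ R)} :
    𝔞.map (C : R →+* MvPolynomial σ R) * P ≤ K ↔ ∀ u ∈ 𝔞, ∀ p ∈ P, C u * p ∈ K := by
  refine ⟨fun h u hu p hp => h (Ideal.mul_mem_mul (Ideal.mem_map_of_mem _ hu) hp), fun h => ?_⟩
  refine Ideal.mul_le.2 fun r hr p hp => ?_
  induction hr using Submodule.span_induction with
  | mem x hx => obtain ⟨u, hu, rfl⟩ := hx; exact h u hu p hp
  | zero => simp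
  | add x y _ _ hx hy => rw [add_mul]; exact K.add_mem hx hy
  | smul a x _ hx => rw [smul_eq_mul, mul_assoc]; exact K.mul_mem_left a hx

/-- A polynomial with coefficients in `𝔞` differs from its value at `c` by an element of
`𝔪_c 𝔞 R[Z]`, where `𝔪_c` is the ideal of the polynomials vanishing at `c`. -/
theorem sub_C_eval_mem_ker_eval_mul_map_C {𝔞 : Ideal R} (c : σ → R) {f : MvPolynomial σ R}
    (hf : f ∈ 𝔞.map (C : R →+* MvPolynomial σ R)) :
    f - C (eval c f) ∈ RingHom.ker (eval c) * 𝔞.map (C : R →+* MvPolynomial σ R) := by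
  induction hf using Submodule.span_induction with
  | mem x hx => obtain ⟨u, hu, rfl⟩ := hx; simp
  | zero => simp
  | add x y _ _ hx hy =>
    have := Ideal.add_mem _ hx hy
    rw [map_add, C_add]
    convert! this using 1
    ring
  | smul a x hx' hx =>
    have h1 : (a - C (eval c a)) * x ∈
        RingHom.ker (eval c) * 𝔞.map (C : R →+* MvPolynomial σ R) :=
      Ideal.mul_mem_mul (by simp [RingHom.mem_ker]) hx'
    have := Ideal.add_mem _ h1 (Ideal.mul_mem_left _ (C (eval c a)) hx)
    rw [smul_eq_mul, map_mul, C_mul]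
    convert! this using 1
    ring

/-- Nakayama's lemma at the point `c`. An inclusion valid modulo the polynomials vanishing at `c`
becomes valid after multiplication by `f`, hence at every point where the value of `f` is a unit. -/
theorem exists_isUnit_eval_mul_le [IsNoetherianRing R] [Finite σ]
    {P Q : Ideal (MvPolynomial σ R)} (c : σ → R)
    (h : P ≤ Q ⊔ RingHom.ker (eval c) * P) :
    ∃ f : MvPolynomial σ R, eval c f = 1 ∧ ∀ p ∈ P, f * p ∈ Q := by
  obtain ⟨f, hf, hfP⟩ := Submodule.exists_sub_one_mem_and_smul_le_of_fg_of_le_sup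
    (IsNoetherian.noetherian P) le_rfl h
  refine ⟨f, ?_, fun p hp => hfP (Submodule.smul_mem_pointwise_smul p f P hp)⟩
  rwa [RingHom.mem_ker, map_sub, map_one, sub_eq_zero] at hf

variable [IsLocalRing R]

theorem eval_map_residue (f : MvPolynomial σ R) (c : σ → R) :
    eval (fun p => residue R (c p)) (map (residue R) f) = residue R (eval c f) := by
  induction f using MvPolynomial.induction_on with
  | C r => simp
  | add p q hp hq => simp [hp, hq]
  | mul_X p i hp => simp [hp]

theorem map_residue_ne_zero_of_isUnit_eval {f : MvPolynomial σ R} (c : σ → R)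
    (hf : IsUnit (eval c f)) : map (residue R) f ≠ 0 := by
  intro h
  have h2 := eval_map_residue f c
  rw [h, map_zero] at h2
  exact (residue_ne_zero_iff_isUnit _).2 hf h2.symm

theorem isUnit_eval_of_eval_map_residue_ne_zero {f : MvPolynomial σ R} {c : σ → R}
    (hf : eval (fun p => residue R (c p)) (map (residue R) f) ≠ 0) : IsUnit (eval c f) := by
  rw [eval_map_residue] at hf
  exact (residue_ne_zero_iff_isUnit _).1 hf

theorem mem_map_C_maximalIdeal_iff {f : MvPolynomial σ R} :
    f ∈ (maximalIdeal R).map (C : R →+* MvPolynomial σ R) ↔ map (residue R) f = 0 := by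
  rw [← RingHom.mem_ker, MvPolynomial.ker_map, ker_residue]

variable [IsNoetherianRing R] [Finite σ]

/-- If the fibre at `c` of `P / Q` is a cyclic module killed by the maximal ideal of `R`, and
`P / Q` is killed by a power of that ideal, then the generic fibre is cyclic and killed by the
maximal ideal. -/
theorem exists_mul_map_C_maximalIdeal_mul_le {P Q : Ideal (MvPolynomial σ R)} (c : σ → R)
    {w : MvPolynomial σ R} (hwP : w ∈ P)
    (hw : P ≤ Ideal.span {w} ⊔ Q ⊔ RingHom.ker (eval c) * P)
    (hm : (maximalIdeal R).map C * P ≤ Q ⊔ RingHom.ker (eval c) * P)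
    {N : ℕ} (hN : (maximalIdeal R ^ N).map C * P ≤ Q) :
    ∃ f : MvPolynomial σ R, map (residue R) f ≠ 0 ∧
      (∀ p ∈ P, f * p ∈ Ideal.span {w} ⊔ Q) ∧
      ∀ u ∈ maximalIdeal R, ∀ p ∈ P, f * (C u * p) ∈ Q := by
  obtain ⟨f₀, hf₀, hf₀P⟩ := exists_isUnit_eval_mul_le c hw
  have hf₀' : map (residue R) f₀ ≠ 0 :=
    map_residue_ne_zero_of_isUnit_eval c (by rw [hf₀]; exact isUnit_one)
  have hf₀P' : ∀ p ∈ P, ∃ b, f₀ * p - b * w ∈ Q := fun p hp => by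
    obtain ⟨x, hx, q, hq, h⟩ := Submodule.mem_sup.1 (hf₀P p hp)
    obtain ⟨b, rfl⟩ := Ideal.mem_span_singleton'.1 hx
    exact ⟨b, by rw [← h]; simpa using hq⟩
  -- After multiplication by `f₀` and modulo `Q`, each element of `P` is a multiple of `w`; the
  -- factor vanishing at `c` passes to the coefficient of `w`.
  have key : ∀ z ∈ RingHom.ker (eval c) * P, ∃ θ ∈ RingHom.ker (eval c),
      f₀ * z - θ * w ∈ Q := by
    intro z hz
    induction hz using Submodule.mul_induction_on' with
    | mem_mul_mem g hg p hp =>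
      obtain ⟨b, hb⟩ := hf₀P' p hp
      refine ⟨g * b, Ideal.mul_mem_right _ _ hg, ?_⟩
      have := Q.mul_mem_left g hb
      convert! this using 1
      ring
    | add x _ y _ hx hy =>
      obtain ⟨θ, hθ, h⟩ := hx
      obtain ⟨η, hη, h'⟩ := hy
      refine ⟨θ + η, Ideal.add_mem _ hθ hη, ?_⟩
      have := Q.add_mem h h'
      convert! this using 1
      ring
  have key2 : ∀ u ∈ maximalIdeal R, ∃ θ ∈ RingHom.ker (eval c), f₀ * C u * w - θ * w ∈ Q := by
    intro u hu
    obtain ⟨q, hq, z, hz, h⟩ := Submodule.mem_sup.1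
      (hm (Ideal.mul_mem_mul (Ideal.mem_map_of_mem C hu) hwP))
    obtain ⟨θ, hθ, h'⟩ := key z hz
    refine ⟨θ, hθ, ?_⟩
    have := Q.add_mem (Q.mul_mem_left f₀ hq) h'
    convert! this using 1
    rw [mul_assoc, ← h]
    ring
  -- Each `u` in the maximal ideal acts on `w`, up to `f₀`, as some `θ` vanishing at `c`. Either
  -- some such `θ` survives modulo the maximal ideal, or none does.
  by_cases hcase : ∃ u ∈ maximalIdeal R, ∃ θ : MvPolynomial σ R,
      map (residue R) θ ≠ 0 ∧ f₀ * C u * w - θ * w ∈ Q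
  · obtain ⟨u, hu, θ, hθ, h⟩ := hcase
    -- Here `θ` acts nilpotently on `w`, as `u` does, so `P / Q` vanishes altogether where `θ * f₀`
    -- is invertible.
    have hpow : (f₀ * C u) ^ N * w - θ ^ N * w ∈ Q := by
      rw [← sub_mul]
      rw [← sub_mul] at h
      obtain ⟨t, ht⟩ := sub_dvd_pow_sub_pow (f₀ * C u) θ N
      rw [ht, mul_right_comm]
      exact Q.mul_mem_right _ h
    have hθN : θ ^ N * w ∈ Q := by
      have h1 : (f₀ * C u) ^ N * w ∈ Q := by
        rw [mul_pow, ← C_pow, mul_assoc]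
        exact Q.mul_mem_left _
          (hN (Ideal.mul_mem_mul (Ideal.mem_map_of_mem C (Ideal.pow_mem_pow hu N)) hwP))
      exact (Submodule.sub_mem_iff_right Q h1).1 hpow
    have hP : ∀ p ∈ P, (θ ^ N * f₀) * p ∈ Q := by
      intro p hp
      obtain ⟨b, hb⟩ := hf₀P' p hp
      have := Q.add_mem (Q.mul_mem_left (θ ^ N) hb) (Q.mul_mem_left b hθN)
      convert! this using 1
      ring
    refine ⟨θ ^ N * f₀, ?_, fun p hp => Ideal.mem_sup_right (hP p hp), fun u hu p hp => ?_⟩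
    · rw [map_mul, map_pow]
      exact mul_ne_zero (pow_ne_zero _ hθ) hf₀'
    · exact hP _ (P.mul_mem_left _ hp)
  · push Not at hcase
    set 𝔪' := (maximalIdeal R).map (C : R →+* MvPolynomial σ R)
    -- Now `θ` both vanishes at `c` and has coefficients in the maximal ideal, so it lies in the
    -- product of the two ideals. This is the hypothesis for a second Nakayama argument, applied to
    -- `𝔪' * P`.
    have hθmem : ∀ u ∈ maximalIdeal R, ∃ θ ∈ RingHom.ker (eval c) * 𝔪',
        f₀ * C u * w - θ * w ∈ Q := by
      intro u hu
      obtain ⟨θ, hθ, h⟩ := key2 u hu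
      have h0 : map (residue R) θ = 0 := by
        by_contra hne
        exact hcase u hu θ hne h
      refine ⟨θ, ?_, h⟩
      have := sub_C_eval_mem_ker_eval_mul_map_C c (mem_map_C_maximalIdeal_iff.2 h0)
      rwa [RingHom.mem_ker.1 hθ, C_0, sub_zero] at this
    have hle : 𝔪' * P ≤ Q ⊔ RingHom.ker (eval c) * (𝔪' * P) := by
      refine map_C_mul_le_iff.2 fun u hu p hp => ?_
      obtain ⟨b, hb⟩ := hf₀P' p hp
      obtain ⟨θ, hθ, h⟩ := hθmem u hu
      have h1 : θ * w ∈ RingHom.ker (eval c) * (𝔪' * P) := by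
        rw [← mul_assoc]
        exact Ideal.mul_mem_mul hθ hwP
      -- One factor `f₀` turns `p` into a multiple of `w`, the other turns `C u * w` into `θ * w`.
      have h2 : (1 - f₀ ^ 2) * (C u * p) ∈ RingHom.ker (eval c) * (𝔪' * P) :=
        Ideal.mul_mem_mul (by simp [RingHom.mem_ker, hf₀])
          (Ideal.mul_mem_mul (Ideal.mem_map_of_mem C hu) hp)
      have h3 : f₀ * C u * (f₀ * p - b * w) + b * (f₀ * C u * w - θ * w) ∈ Q :=
        Q.add_mem (Q.mul_mem_left _ hb) (Q.mul_mem_left _ h)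
      have h4 := Ideal.add_mem _ h2 (Ideal.mul_mem_left _ b h1)
      have := Submodule.add_mem_sup h3 h4
      convert! this using 1
      ring
    obtain ⟨f, hf, hfP⟩ := exists_isUnit_eval_mul_le c hle
    refine ⟨f * f₀, ?_, fun p hp => ?_, fun u hu p hp => ?_⟩
    · rw [map_mul]
      exact mul_ne_zero
        (map_residue_ne_zero_of_isUnit_eval c (by rw [hf]; exact isUnit_one)) hf₀'
    · rw [mul_assoc]
      exact Ideal.mul_mem_left _ _ (hf₀P p hp)
    · rw [mul_right_comm]
      exact Q.mul_mem_right _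
        (hfP _ (Ideal.mul_mem_mul (Ideal.mem_map_of_mem C hu) hp))

end PolynomialFamily

/-! ### Openness of the reduction and length conditions -/

section GeneralCombinations

open IsLocalRing MvPolynomial

variable {R : Type*} [CommRing R] {d s : ℕ} (a : Fin s → R)

/-- The ideal of `R[Z]` generated by the `d` generic combinations `∑ j, Z i j * a j`. -/
noncomputable def genericCombinations (d : ℕ) (a : Fin s → R) :
    Ideal (MvPolynomial (Fin d × Fin s) R) :=
  idealOfCombinations (fun i j => X (i, j)) (fun j => C (a j))

theorem idealOfCombinations_le_span (c : Fin d → Fin s → R) :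
    idealOfCombinations c a ≤ Ideal.span (Set.range a) := by
  refine Ideal.span_le.2 ?_
  rintro _ ⟨i, rfl⟩
  exact Ideal.sum_mem _ fun j _ => Ideal.mul_mem_left _ _ (Ideal.subset_span ⟨j, rfl⟩)

theorem map_eval_genericCombinations (c : Fin d → Fin s → R) :
    (genericCombinations d a).map (eval fun p => c p.1 p.2) = idealOfCombinations c a := by
  rw [genericCombinations, idealOfCombinations, idealOfCombinations, Ideal.map_span,
    ← Set.range_comp]
  simp [Function.comp_def]

theorem map_eval_map_C {σ : Type*} (c : σ → R) (I : Ideal R) :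
    (I.map (C : R →+* MvPolynomial σ R)).map (eval c) = I := by
  rw [Ideal.map_map]
  convert! Ideal.map_id I
  ext
  simp

/-- The constant `c i j` and the variable `Z i j` agree at `c`. This turns inclusions for the ideal
at `c` into hypotheses for Nakayama about the generic ideal. -/
theorem map_C_idealOfCombinations_le (c : Fin d → Fin s → R) :
    (idealOfCombinations c a).map C ≤ genericCombinations d a ⊔
      RingHom.ker (eval fun p : Fin d × Fin s => c p.1 p.2) *
        (Ideal.span (Set.range a)).map C := by
  rw [idealOfCombinations, Ideal.map_span, Ideal.span_le]
  rintro _ ⟨_, ⟨i, rfl⟩, rfl⟩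
  have h1 : ∑ j, X (i, j) * C (a j) ∈ genericCombinations d a := Ideal.subset_span ⟨i, rfl⟩
  have h2 : ∑ j, (C (c i j) - X (i, j)) * C (a j) ∈
      RingHom.ker (eval fun p : Fin d × Fin s => c p.1 p.2) *
        (Ideal.span (Set.range a)).map C :=
    Ideal.sum_mem _ fun j _ => Ideal.mul_mem_mul (by simp [RingHom.mem_ker])
      (Ideal.mem_map_of_mem C (Ideal.subset_span ⟨j, rfl⟩))
  have := Submodule.add_mem_sup h1 h2
  rw [← Finset.sum_add_distrib] at this
  convert! this using 1
  simp only [map_sum, map_mul]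
  exact Finset.sum_congr rfl fun j _ => by ring

variable [IsLocalRing R] [IsNoetherianRing R]

/-- The condition `I ^ (r + 1) = J I ^ r` is open in the coefficients of the generators
of `J`. -/
theorem exists_pow_succ_le_idealOfCombinations_mul_pow (c₀ : Fin d → Fin s → R) (r : ℕ)
    (h : Ideal.span (Set.range a) ^ (r + 1) ≤
      idealOfCombinations c₀ a * Ideal.span (Set.range a) ^ r) :
    ∃ f : MvPolynomial (Fin d × Fin s) (ResidueField R), f ≠ 0 ∧ ∀ c : Fin d → Fin s → R,
      eval (fun p => residue R (c p.1 p.2)) f ≠ 0 →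
        Ideal.span (Set.range a) ^ (r + 1) ≤
          idealOfCombinations c a * Ideal.span (Set.range a) ^ r := by
  set I := Ideal.span (Set.range a) with hI
  have hle : (I ^ (r + 1)).map C ≤ genericCombinations d a * (I ^ r).map C ⊔
      RingHom.ker (eval fun p : Fin d × Fin s => c₀ p.1 p.2) * (I ^ (r + 1)).map C := by
    refine (Ideal.map_mono h).trans ?_
    rw [Ideal.map_mul]
    refine (Ideal.mul_mono_left (map_C_idealOfCombinations_le a c₀)).trans ?_
    rw [Ideal.sup_mul, mul_assoc, ← Ideal.map_mul, ← hI, ← pow_succ']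
  obtain ⟨f, hf, hfP⟩ := exists_isUnit_eval_mul_le _ hle
  refine ⟨map (residue R) f, map_residue_ne_zero_of_isUnit_eval _ (by rw [hf]; exact isUnit_one),
    fun c hc x hx => ?_⟩
  have hu : IsUnit (eval (fun p => c p.1 p.2) f) := isUnit_eval_of_eval_map_residue_ne_zero hc
  have := Ideal.mem_map_of_mem (eval fun p => c p.1 p.2) (hfP _ (Ideal.mem_map_of_mem C hx))
  rw [Ideal.map_mul, map_eval_genericCombinations, map_eval_map_C, map_mul, eval_C] at this
  exact (Ideal.unit_mul_mem_iff_mem _ hu).1 this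

/-- The condition that `I ^ 2 / (I ^ 3 + J I)` has length at most one is open in the coefficients
of the generators of `J`. -/
theorem exists_sq_le_span_singleton_sup (c₀ : Fin d → Fin s → R) {w : R} {N : ℕ}
    (hN : maximalIdeal R ^ N ≤ Ideal.span (Set.range a))
    (hw : w ∈ Ideal.span (Set.range a) ^ 2)
    (h : Ideal.span (Set.range a) ^ 2 ≤ Ideal.span {w} ⊔ (Ideal.span (Set.range a) ^ 3 ⊔
      idealOfCombinations c₀ a * Ideal.span (Set.range a)))
    (hm : maximalIdeal R * Ideal.span (Set.range a) ^ 2 ≤ Ideal.span (Set.range a) ^ 3 ⊔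
      idealOfCombinations c₀ a * Ideal.span (Set.range a)) :
    ∃ f : MvPolynomial (Fin d × Fin s) (ResidueField R), f ≠ 0 ∧ ∀ c : Fin d → Fin s → R,
      eval (fun p => residue R (c p.1 p.2)) f ≠ 0 →
        Ideal.span (Set.range a) ^ 2 ≤ Ideal.span {w} ⊔ (Ideal.span (Set.range a) ^ 3 ⊔
          idealOfCombinations c a * Ideal.span (Set.range a)) ∧
        maximalIdeal R * Ideal.span (Set.range a) ^ 2 ≤ Ideal.span (Set.range a) ^ 3 ⊔
          idealOfCombinations c a * Ideal.span (Set.range a) := by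
  set I := Ideal.span (Set.range a) with hI
  set Q : Ideal (MvPolynomial (Fin d × Fin s) R) :=
    (I ^ 3).map C ⊔ genericCombinations d a * I.map C with hQ
  have hle : (I ^ 3 ⊔ idealOfCombinations c₀ a * I).map C ≤ Q ⊔
      RingHom.ker (eval fun p : Fin d × Fin s => c₀ p.1 p.2) * (I ^ 2).map C := by
    rw [Ideal.map_sup, Ideal.map_mul, hQ, sup_assoc]
    refine sup_le_sup_left ?_ _
    refine (Ideal.mul_mono_left (map_C_idealOfCombinations_le a c₀)).trans ?_
    rw [Ideal.sup_mul, mul_assoc, ← Ideal.map_mul, ← hI, ← sq]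
  obtain ⟨f, hf, hfw, hfm⟩ := exists_mul_map_C_maximalIdeal_mul_le (P := (I ^ 2).map C) (Q := Q)
    (fun p : Fin d × Fin s => c₀ p.1 p.2) (Ideal.mem_map_of_mem C hw)
    (by
      refine (Ideal.map_mono h).trans ?_
      rw [Ideal.map_sup, Ideal.map_span, Set.image_singleton, sup_assoc]
      exact sup_le_sup_left hle _)
    (by
      rw [← Ideal.map_mul]
      exact (Ideal.map_mono hm).trans hle)
    (N := N)
    (by
      rw [← Ideal.map_mul]
      refine (Ideal.map_mono (Ideal.mul_mono_left hN)).trans ?_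
      rw [← pow_succ']
      exact le_sup_left)
  have hQc : ∀ c : Fin d → Fin s → R, Q.map (eval fun p => c p.1 p.2) =
      I ^ 3 ⊔ idealOfCombinations c a * I := fun c => by
    rw [hQ, Ideal.map_sup, Ideal.map_mul, map_eval_map_C, map_eval_map_C,
      map_eval_genericCombinations]
  refine ⟨map (residue R) f, hf, fun c hc => ?_⟩
  have hu : IsUnit (eval (fun p => c p.1 p.2) f) := isUnit_eval_of_eval_map_residue_ne_zero hc
  refine ⟨fun x hx => ?_, Ideal.mul_le.2 fun u hu' x hx => ?_⟩
  · have := Ideal.mem_map_of_mem (eval fun p => c p.1 p.2) (hfw _ (Ideal.mem_map_of_mem C hx))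
    rw [Ideal.map_sup, hQc, Ideal.map_span, Set.image_singleton, map_mul, eval_C, eval_C] at this
    exact (Ideal.unit_mul_mem_iff_mem _ hu).1 this
  · have := Ideal.mem_map_of_mem (eval fun p => c p.1 p.2)
      (hfm u hu' _ (Ideal.mem_map_of_mem C hx))
    rw [hQc, map_mul, map_mul, eval_C, eval_C] at this
    exact (Ideal.unit_mul_mem_iff_mem _ hu).1 this

end GeneralCombinations

/-! ### Openness of injectivity over a field -/

section InjectiveFamily

open MvPolynomial

/-- Compose the family with a left inverse of its member at `c₀`: the determinant of the resulting
endomorphism is polynomial in `c`, equals one at `c₀`, and forces injectivity where it is nonzero.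
-/
theorem exists_injective_sum_smul {k σ V W : Type*} [Field k] [Fintype σ]
    [AddCommGroup V] [Module k V] [FiniteDimensional k V] [AddCommGroup W] [Module k W]
    (φ : σ → V →ₗ[k] W) (c₀ : σ → k) (h₀ : Function.Injective (∑ p, c₀ p • φ p : V →ₗ[k] W)) :
    ∃ f : MvPolynomial σ k, f ≠ 0 ∧ ∀ c : σ → k, eval c f ≠ 0 →
      Function.Injective (∑ p, c p • φ p : V →ₗ[k] W) := by
  classical
  obtain ⟨g, hg⟩ := LinearMap.exists_leftInverse_of_injective _ (LinearMap.ker_eq_bot.2 h₀)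
  let b := Module.finBasis k V
  let A : σ → Matrix _ _ k := fun p => LinearMap.toMatrix b b (g ∘ₗ φ p)
  let f : MvPolynomial σ k := (∑ p, (X p : MvPolynomial σ k) • (A p).map C).det
  have hf : ∀ c, eval c f = LinearMap.det (g ∘ₗ (∑ p, c p • φ p)) := by
    intro c
    rw [← LinearMap.det_toMatrix b, RingHom.map_det]
    congr 1
    ext i j
    simp [A, Matrix.sum_apply, LinearMap.toMatrix_apply]
  refine ⟨f, ?_, fun c hc => ?_⟩
  · intro h
    have := hf c₀
    rw [h, hg, LinearMap.det_id, map_zero] at this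
    exact zero_ne_one this
  · rw [hf] at hc
    have := (LinearMap.equivOfDetNeZero _ hc).injective
    exact Function.Injective.of_comp (f := g) this

end InjectiveFamily

/-! ### Openness of injectivity over a local ring, via socles -/

section Socle

open IsLocalRing

variable {R : Type*} [CommRing R] [IsLocalRing R]

/-- Take `c` in the last power of the maximal ideal that does not kill `x`. Thus every nonzero
submodule meets the socle, and injectivity can be tested there. -/
theorem exists_smul_ne_zero_of_pow_smul_eq_zero {M : Type*} [AddCommGroup M] [Module R M] {x : M}
    (hx : x ≠ 0) {N : ℕ} (hN : ∀ u ∈ maximalIdeal R ^ N, u • x = 0) :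
    ∃ c : R, c • x ≠ 0 ∧ ∀ u ∈ maximalIdeal R, u • c • x = 0 := by
  induction N with
  | zero => exact absurd (by simpa using hN 1 (by simp)) hx
  | succ N ih =>
    by_cases h : ∀ u ∈ maximalIdeal R ^ N, u • x = 0
    · exact ih h
    · push Not at h
      obtain ⟨c, hc, hcx⟩ := h
      refine ⟨c, hcx, fun u hu => ?_⟩
      rw [smul_smul]
      exact hN _ (by rw [pow_succ']; exact Ideal.mul_mem_mul hu hc)

/-- The socle of a module over a local ring. -/
abbrev socle (R M : Type*) [CommRing R] [IsLocalRing R] [AddCommGroup M] [Module R M] :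
    Submodule R M :=
  Submodule.torsionBySet R M (maximalIdeal R)

instance (M : Type*) [AddCommGroup M] [Module R M] : Module (ResidueField R) (socle R M) :=
  inferInstanceAs (Module (R ⧸ maximalIdeal R) (Submodule.torsionBySet R M (maximalIdeal R)))

instance (M : Type*) [AddCommGroup M] [Module R M] :
    IsScalarTower R (ResidueField R) (socle R M) :=
  inferInstanceAs (IsScalarTower R (R ⧸ maximalIdeal R)
    (Submodule.torsionBySet R M (maximalIdeal R)))

theorem mem_socle_iff {M : Type*} [AddCommGroup M] [Module R M] {x : M} :
    x ∈ socle R M ↔ ∀ u ∈ maximalIdeal R, u • x = 0 := by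
  simp [socle, Submodule.mem_torsionBySet_iff]

/-- The map between socles induced by a linear map, as a linear map over the residue field. -/
noncomputable def LinearMap.socleMap {M M' : Type*} [AddCommGroup M] [Module R M]
    [AddCommGroup M'] [Module R M'] (f : M →ₗ[R] M') :
    socle R M →ₗ[ResidueField R] socle R M' :=
  LinearMap.extendScalarsOfSurjective residue_surjective
    (f.restrict fun x hx => mem_socle_iff.2 fun u hu => by
      rw [← map_smul, mem_socle_iff.1 hx u hu, map_zero])

theorem LinearMap.coe_socleMap {M M' : Type*} [AddCommGroup M] [Module R M]
    [AddCommGroup M'] [Module R M'] (f : M →ₗ[R] M') (x : socle R M) :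
    (f.socleMap x : M') = f x := rfl

theorem coe_residue_smul_socle {M : Type*} [AddCommGroup M] [Module R M] (r : R)
    (x : socle R M) : ((residue R r • x : socle R M) : M) = r • (x : M) := by
  rw [← Submodule.coe_smul]
  exact congrArg _ (IsScalarTower.algebraMap_smul (ResidueField R) r x)

/-- If `∑ p, c₀ p • φ p` is injective on a module `M` killed by a power of the maximal ideal,
then so is `∑ p, c p • φ p` for all `c` in an open set. -/
theorem exists_injective_sum_smul_of_pow_smul_eq_zero [IsNoetherianRing R] {σ M M' : Type*}
    [Fintype σ] [AddCommGroup M] [Module R M] [Module.Finite R M] [AddCommGroup M'] [Module R M']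
    {N : ℕ} (hN : ∀ u ∈ maximalIdeal R ^ N, ∀ x : M, u • x = 0)
    (φ : σ → M →ₗ[R] M') (c₀ : σ → R)
    (h₀ : Function.Injective (∑ p, c₀ p • φ p : M →ₗ[R] M')) :
    ∃ f : MvPolynomial σ (ResidueField R), f ≠ 0 ∧ ∀ c : σ → R,
      MvPolynomial.eval (fun p => residue R (c p)) f ≠ 0 →
        Function.Injective (∑ p, c p • φ p : M →ₗ[R] M') := by
  have hcoe : ∀ (c : σ → R) (x : socle R M),
      (((∑ p, residue R (c p) • (φ p).socleMap) x : socle R M') : M') =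
        (∑ p, c p • φ p) (x : M) := fun c x => by
    simp [LinearMap.sum_apply, coe_residue_smul_socle, LinearMap.coe_socleMap]
  have : Module.Finite (ResidueField R) (socle R M) :=
    Module.Finite.of_restrictScalars_finite R _ _
  obtain ⟨f, hf, hfc⟩ := exists_injective_sum_smul (fun p => (φ p).socleMap)
    (fun p => residue R (c₀ p)) (by
      refine (injective_iff_map_eq_zero _).2 fun x hx => ?_
      have := hcoe c₀ x
      rw [hx, Submodule.coe_zero] at this
      exact Subtype.ext ((injective_iff_map_eq_zero _).1 h₀ _ this.symm))
  refine ⟨f, hf, fun c hc => (injective_iff_map_eq_zero _).2 fun x hx => ?_⟩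
  by_contra hne
  obtain ⟨e, hex, hem⟩ := exists_smul_ne_zero_of_pow_smul_eq_zero hne fun u hu => hN u hu x
  have h1 : (∑ p, residue R (c p) • (φ p).socleMap) ⟨e • x, mem_socle_iff.2 hem⟩ = 0 := by
    refine Subtype.ext ?_
    rw [hcoe, map_smul, hx, smul_zero, Submodule.coe_zero]
  exact hex (congrArg Subtype.val ((injective_iff_map_eq_zero _).1 (hfc _ hc) _ h1))

variable [IsNoetherianRing R] {d s : ℕ} (a : Fin s → R)

/-- The linear independence modulo `I` of the generators of `J` in `I / I ^ 2` is open in the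
coefficients of these generators. -/
theorem exists_forall_sum_mul_mem_sq (c₀ : Fin d → Fin s → R) {N : ℕ}
    (hN : maximalIdeal R ^ N ≤ Ideal.span (Set.range a))
    (h₀ : ∀ r : Fin d → R, ∑ i, r i * ∑ j, c₀ i j * a j ∈ Ideal.span (Set.range a) ^ 2 →
      ∀ i, r i ∈ Ideal.span (Set.range a)) :
    ∃ f : MvPolynomial (Fin d × Fin s) (ResidueField R), f ≠ 0 ∧ ∀ c : Fin d → Fin s → R,
      MvPolynomial.eval (fun p => residue R (c p.1 p.2)) f ≠ 0 →
        ∀ r : Fin d → R, ∑ i, r i * ∑ j, c i j * a j ∈ Ideal.span (Set.range a) ^ 2 →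
          ∀ i, r i ∈ Ideal.span (Set.range a) := by
  set I := Ideal.span (Set.range a) with hI
  have ha : ∀ j, a j ∈ I := fun j => Ideal.subset_span ⟨j, rfl⟩
  -- The map for `(i, j)` is `r ↦ a j * r i`, so the combination with coefficients `c` sends `r` to
  -- `∑ i, r i * x i`.
  let φ : Fin d × Fin s → (Fin d → R ⧸ I) →ₗ[R] R ⧸ I ^ 2 := fun p =>
    (Submodule.mapQ I (I ^ 2) (LinearMap.mulLeft R (a p.2)) fun x hx => by
      rw [Submodule.mem_comap, LinearMap.mulLeft_apply, sq]
      exact Ideal.mul_mem_mul (ha _) hx) ∘ₗ LinearMap.proj p.1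
  have hφ : ∀ (c : Fin d → Fin s → R) (r : Fin d → R),
      (∑ p, c p.1 p.2 • φ p) (fun i => Ideal.Quotient.mk I (r i)) =
        Ideal.Quotient.mk (I ^ 2) (∑ i, r i * ∑ j, c i j * a j) := fun c r => by
    have : ∀ p : Fin d × Fin s, φ p (fun i => Ideal.Quotient.mk I (r i)) =
      Ideal.Quotient.mk (I ^ 2) (a p.2 * r p.1) := fun p => rfl
    simp only [LinearMap.sum_apply, LinearMap.smul_apply, this, Finset.mul_sum]
    rw [Fintype.sum_prod_type, map_sum]
    refine Finset.sum_congr rfl fun i _ => ?_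
    rw [map_sum]
    refine Finset.sum_congr rfl fun j _ => ?_
    rw [Algebra.smul_def, Ideal.Quotient.algebraMap_eq, ← map_mul]
    congr 1
    ring
  have hiff : ∀ c : Fin d → Fin s → R, Function.Injective (∑ p, c p.1 p.2 • φ p : (Fin d → R ⧸ I) →ₗ[R] R ⧸ I ^ 2) ↔
      ∀ r : Fin d → R, ∑ i, r i * ∑ j, c i j * a j ∈ I ^ 2 → ∀ i, r i ∈ I := by
    intro c
    rw [injective_iff_map_eq_zero]
    constructor
    · intro h r hr i
      have := h (fun i => Ideal.Quotient.mk I (r i))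
        (by rw [hφ, Ideal.Quotient.eq_zero_iff_mem]; exact hr)
      exact Ideal.Quotient.eq_zero_iff_mem.1 (congrFun this i)
    · intro h x hx
      choose r hr using fun i => Ideal.Quotient.mk_surjective (x i)
      obtain rfl : (fun i => Ideal.Quotient.mk I (r i)) = x := funext hr
      rw [hφ, Ideal.Quotient.eq_zero_iff_mem] at hx
      exact funext fun i => Ideal.Quotient.eq_zero_iff_mem.2 (h r hx i)
  obtain ⟨f, hf, hfc⟩ := exists_injective_sum_smul_of_pow_smul_eq_zero (N := N)
    (fun u hu x => by
      funext i
      obtain ⟨y, hy⟩ := Ideal.Quotient.mk_surjective (x i)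
      rw [Pi.smul_apply, Pi.zero_apply, ← hy, Algebra.smul_def, Ideal.Quotient.algebraMap_eq,
        ← map_mul, Ideal.Quotient.eq_zero_iff_mem]
      exact I.mul_mem_right _ (hN hu))
    φ (fun p => c₀ p.1 p.2) ((hiff c₀).2 h₀)
  exact ⟨f, hf, fun c hc => (hiff c).1 (hfc (fun p => c p.1 p.2) hc)⟩

end Socle

/-! ### Systems of parameters in Cohen-Macaulay rings -/

section SystemsOfParameters

open IsLocalRing RingTheory.Sequence Pointwise

universe u

/-- Krull's height theorem: the maximal ideal is a minimal prime over the ideal generated by `l`. -/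
theorem ringKrullDim_le_length_of_maximalIdeal_le_radical {S : Type*} [CommRing S]
    [IsLocalRing S] [IsNoetherianRing S] (l : List S) (hl : ∀ x ∈ l, x ∈ maximalIdeal S)
    (h : maximalIdeal S ≤ (Ideal.ofList l).radical) : ringKrullDim S ≤ l.length := by
  classical
  have hmin : maximalIdeal S ∈ (Ideal.span (l.toFinset : Set S)).minimalPrimes := by
    have hspan : Ideal.span (l.toFinset : Set S) = Ideal.ofList l := by
      rw [Ideal.ofList, List.coe_toFinset]
    rw [hspan]
    refine ⟨⟨inferInstance, Ideal.span_le.2 fun x hx => hl x hx⟩, fun q hq _ => ?_⟩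
    exact h.trans (hq.1.radical_le_iff.2 hq.2)
  rw [← maximalIdeal_height_eq_ringKrullDim]
  have h1 := Ideal.height_le_card_of_mem_minimalPrimes_span_finset hmin
  have h2 : ((l.toFinset.card : ℕ) : ℕ∞) ≤ l.length := by exact_mod_cast l.toFinset_card_le
  exact_mod_cast h1.trans h2

variable {R : Type u} [CommRing R] [IsLocalRing R] [IsNoetherianRing R]

theorem ringKrullDim_quotient_le_length_of_maximalIdeal_le_radical {P : Ideal R} (hP : P.IsPrime)
    (l : List R) (hl : ∀ x ∈ l, x ∈ maximalIdeal R)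
    (h : maximalIdeal R ≤ (P ⊔ Ideal.ofList l).radical) :
    ringKrullDim (R ⧸ P) ≤ l.length := by
  have : Nontrivial (R ⧸ P) := Ideal.Quotient.nontrivial_iff.2 hP.ne_top
  have : IsLocalRing (R ⧸ P) :=
    IsLocalRing.of_surjective' (Ideal.Quotient.mk P) Ideal.Quotient.mk_surjective
  have hmap : (maximalIdeal R).map (Ideal.Quotient.mk P) = maximalIdeal (R ⧸ P) :=
    IsLocalRing.map_maximalIdeal_of_surjective _ Ideal.Quotient.mk_surjective
  have := ringKrullDim_le_length_of_maximalIdeal_le_radical (l.map (Ideal.Quotient.mk P))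
    (fun x hx => by
      obtain ⟨y, hy, rfl⟩ := List.mem_map.1 hx
      rw [← hmap]
      exact Ideal.mem_map_of_mem _ (hl y hy))
    (by
      rw [← hmap, ← Ideal.map_ofList]
      refine (Ideal.map_mono h).trans ((Ideal.map_radical_le _).trans ?_)
      rw [Ideal.map_sup, Ideal.map_quotient_self, bot_sup_eq])
  simpa using this

/-- The depth of a module is at most the dimension of each of its associated primes. -/
theorem RingTheory.Sequence.IsRegular.length_le_ringKrullDim_quotient
    {M : Type u} [AddCommGroup M] [Module R M] [Module.Finite R M] {rs : List R}
    (hrs : IsRegular M rs) {P : Ideal R} (hP : IsAssociatedPrime P M) :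
    (rs.length : WithBot ℕ∞) ≤ ringKrullDim (R ⧸ P) := by
  induction rs generalizing M P with
  | nil =>
    have : Nontrivial (R ⧸ P) := Ideal.Quotient.nontrivial_iff.2 hP.isPrime.ne_top
    simpa using ringKrullDim_nonneg_of_nontrivial
  | cons x rs ih =>
    have hxm : x ∈ maximalIdeal R := by
      by_contra hx
      refine hrs.2 ?_
      have hu : IsUnit x := by simpa using hx
      simp [Ideal.span_singleton_eq_top.2 hu]
    obtain ⟨hx, hrs'⟩ := (isRegular_cons_iff M x rs).1 hrs
    obtain ⟨hprime, z, hz⟩ := isAssociatedPrime_iff.1 hP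
    have hPz : ∀ u, u ∈ P ↔ u • z = 0 := fun u => by rw [hz]; simp [Submodule.mem_colon_singleton]
    have hz0 : z ≠ 0 := by
      rintro rfl
      exact hprime.ne_top ((Ideal.eq_top_iff_one _).2 ((hPz 1).2 (smul_zero _)))
    have hxP : x ∉ P := fun h => hz0 (hx (by simpa using (hPz x).1 h))
    let N : Submodule R M := Submodule.torsionBySet R M P
    have hNmem : ∀ y, y ∈ N ↔ ∀ u ∈ P, u • y = 0 := fun y => by
      simp [N, Submodule.mem_torsionBySet_iff]
    -- Otherwise `N ≤ x • N`, since `x` is regular, and Nakayama gives `N = 0` although `z ∈ N`. The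
    -- class of `y` then yields an associated prime of `M / xM` containing both `P` and `x`, so the
    -- dimension drops.
    obtain ⟨y, hyN, hy⟩ : ∃ y ∈ N, y ∉ x • (⊤ : Submodule R M) := by
      by_contra! hcon
      have hle : N ≤ x • N := by
        intro y hy
        obtain ⟨t, -, rfl⟩ := (Submodule.mem_smul_pointwise_iff_exists _ _ _).1 (hcon y hy)
        refine Submodule.smul_mem_pointwise_smul _ _ _ ((hNmem t).2 fun u hu => hx ?_)
        have := (hNmem _).1 hy u hu
        rw [smul_comm] at this
        simpa using this
      have hbot := Submodule.eq_bot_of_le_smul_of_le_jacobson_bot (Ideal.span {x}) N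
        (IsNoetherian.noetherian N) (by rwa [Submodule.ideal_span_singleton_smul])
        (by
          rw [IsLocalRing.jacobson_eq_maximalIdeal _ bot_ne_top]
          simpa using hxm)
      have : z ∈ N := (hNmem z).2 fun u hu => (hPz u).1 hu
      rw [hbot] at this
      exact hz0 (by simpa using this)
    have hy' : (Submodule.Quotient.mk y : QuotSMulTop x M) ≠ 0 := by
      simpa [Submodule.Quotient.mk_eq_zero] using hy
    obtain ⟨P', hP', hle⟩ := exists_le_isAssociatedPrime_of_isNoetherianRing R _ hy'
    have hPP' : P ≤ P' := fun u hu => hle (by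
      rw [Submodule.mem_colon_singleton, ← Submodule.Quotient.mk_smul, (hNmem y).1 hyN u hu]
      simp)
    have hxP' : x ∈ P' := hle (by
      rw [Submodule.mem_colon_singleton, ← Submodule.Quotient.mk_smul, Submodule.mem_bot,
        Submodule.Quotient.mk_eq_zero]
      exact Submodule.smul_mem_pointwise_smul _ _ _ trivial)
    have h1 := ih hrs' hP'
    have h2 : ringKrullDim (R ⧸ P') + 1 ≤ ringKrullDim (R ⧸ P) :=
      ringKrullDim_succ_le_of_surjective (Ideal.Quotient.factor hPP')
        (Ideal.Quotient.factor_surjective hPP') (r := Ideal.Quotient.mk P x)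
        (mem_nonZeroDivisors_of_ne_zero (by rwa [Ne, Ideal.Quotient.eq_zero_iff_mem]))
        (by rw [Ideal.Quotient.factor_mk, Ideal.Quotient.eq_zero_iff_mem]; exact hxP')
    refine le_trans ?_ h2
    rw [List.length_cons, Nat.cast_add, Nat.cast_one]
    gcongr

open CategoryTheory CategoryTheory.Abelian in
/-- Regular sequences may be assumed to start with any given regular element. -/
theorem RingTheory.Sequence.IsRegular.exists_isRegular_quotSMulTop
    {M : Type u} [AddCommGroup M] [Module R M] [Module.Finite R M] {rs : List R} {n : ℕ}
    (hrs : IsRegular M rs) (hlen : rs.length = n + 1) {x : R} (hx : IsSMulRegular M x)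
    (hxm : x ∈ maximalIdeal R) (hmem : ∀ r ∈ rs, r ∈ maximalIdeal R) :
    ∃ ts : List R, ts.length = n ∧ IsRegular (QuotSMulTop x M) ts := by
  have : Nontrivial M := hrs.nontrivial
  have : Nontrivial (QuotSMulTop x M) := nontrivial_quotSMulTop_of_mem_maximalIdeal M hxm
  have hlt : ∀ (L : Type u) [AddCommGroup L] [Module R L] [Module.Finite R L] [Nontrivial L],
      maximalIdeal R • (⊤ : Submodule R L) < ⊤ := fun L _ _ _ _ =>
    lt_top_iff_ne_top.2 (Submodule.top_ne_ideal_smul_of_le_jacobson_annihilator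
      (maximalIdeal_le_jacobson _)).symm
  have hsupp : Module.support R (R ⧸ maximalIdeal R) =
      PrimeSpectrum.zeroLocus (maximalIdeal R) := by
    rw [Module.support_eq_zeroLocus, Ideal.annihilator_quotient]
  -- Depth is read off from the vanishing of Ext out of the residue field; the long exact sequence
  -- of multiplication by `x` loses exactly one degree.
  have hext := ModuleCat.subsingleton_ext_of_exists_isRegular (maximalIdeal R)
    (ModuleCat.of R (R ⧸ maximalIdeal R)) hsupp.subset (ModuleCat.of R M) (hlt M) rs hmem hrs
  obtain ⟨ts, hts, -, hreg⟩ := ModuleCat.exists_isRegular_of_exists_subsingleton_ext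
    (maximalIdeal R) n (ModuleCat.of R (QuotSMulTop x M)) (hlt _)
    (ModuleCat.of R (R ⧸ maximalIdeal R)) hsupp (fun i hi => by
      have hx' : IsSMulRegular (ModuleCat.of R M) x := hx
      have zero1 := AddCommGrpCat.isZero_of_iff_subsingleton.mpr (hext i (by omega))
      have zero2 := AddCommGrpCat.isZero_of_iff_subsingleton.mpr (hext (i + 1) (by omega))
      exact AddCommGrpCat.subsingleton_of_isZero <| ShortComplex.Exact.isZero_of_both_zeros
        ((Ext.covariant_sequence_exact₃' (ModuleCat.of R (R ⧸ maximalIdeal R))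
          hx'.smulShortComplex_shortExact) i (i + 1) rfl)
        (zero1.eq_zero_of_src _) (zero2.eq_zero_of_tgt _))
  exact ⟨ts, hts, hreg⟩

/-- If the depth of `M` is at least `l.length` and `l` generates an ideal which is primary to the
maximal ideal modulo the annihilator of `M`, then `l` is `M`-regular. -/
theorem RingTheory.Sequence.IsRegular.of_maximalIdeal_le_radical
    {M : Type u} [AddCommGroup M] [Module R M] [Module.Finite R M] {rs : List R}
    (hrs : IsRegular M rs) (l : List R) (hlen : rs.length = l.length)
    (hl : ∀ x ∈ l, x ∈ maximalIdeal R)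
    (h : maximalIdeal R ≤ (Module.annihilator R M ⊔ Ideal.ofList l).radical) :
    IsRegular M l := by
  induction l generalizing M rs with
  | nil =>
    have : Nontrivial M := hrs.nontrivial
    exact IsRegular.nil R M
  | cons x l ih =>
    have hmem : ∀ r ∈ rs, r ∈ maximalIdeal R := fun r hr => by
      refine IsLocalRing.le_maximalIdeal ?_ (Ideal.subset_span (show r ∈ {x | x ∈ rs} from hr))
      exact hrs.2 ∘ Eq.trans (Submodule.top_smul _).symm ∘ Eq.symm ∘ congrArg (· • ⊤)
    -- A zero divisor `x` would lie in an associated prime `P`. Then `l` alone would bound the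
    -- dimension of `R / P` by `l.length`, below the depth `l.length + 1`.
    have hx : IsSMulRegular M x := by
      by_contra hx
      obtain ⟨z, hz0, hz⟩ : ∃ z : M, z ≠ 0 ∧ x • z = 0 := by
        by_contra! hcon
        exact hx (isSMulRegular_iff_right_eq_zero_of_smul.2 fun z hz =>
          by_contra fun h0 => hcon z h0 hz)
      obtain ⟨P, hP, hle⟩ := exists_le_isAssociatedPrime_of_isNoetherianRing R z hz0
      have hxP : x ∈ P := hle (by simpa [Submodule.mem_colon_singleton] using hz)
      have hann : Module.annihilator R M ≤ P := by
        rw [← Submodule.annihilator_top]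
        exact hP.annihilator_le
      have h1 := hrs.length_le_ringKrullDim_quotient hP
      have h2 := ringKrullDim_quotient_le_length_of_maximalIdeal_le_radical hP.isPrime l
        (fun y hy => hl y (List.mem_cons_of_mem _ hy))
        (h.trans (Ideal.radical_mono (by
          rw [Ideal.ofList_cons, ← sup_assoc]
          exact sup_le_sup_right
            (sup_le hann ((Ideal.span_singleton_le_iff_mem _).2 hxP)) _)))
      have h3 := h1.trans h2
      rw [hlen, List.length_cons] at h3
      have : l.length + 1 ≤ l.length := by exact_mod_cast h3
      omega
    obtain ⟨ts, hts, hreg⟩ := hrs.exists_isRegular_quotSMulTop hlen hx (hl x (by simp)) hmem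
    refine IsRegular.cons hx (ih hreg hts (fun y hy => hl y (List.mem_cons_of_mem _ hy)) ?_)
    refine h.trans (Ideal.radical_mono ?_)
    rw [Ideal.ofList_cons, ← sup_assoc]
    refine sup_le_sup_right (sup_le ?_ ((Ideal.span_singleton_le_iff_mem _).2 ?_)) _
    · exact LinearMap.annihilator_le_of_surjective _ (Submodule.mkQ_surjective _)
    · refine Module.mem_annihilator.2 fun q => ?_
      obtain ⟨y, rfl⟩ := Submodule.Quotient.mk_surjective _ q
      rw [← Submodule.Quotient.mk_smul, Submodule.Quotient.mk_eq_zero]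
      exact Submodule.smul_mem_pointwise_smul _ _ _ trivial

/-- The coefficients of a relation between the members of a system of parameters of a
Cohen-Macaulay ring lie in the ideal generated by the system. -/
theorem mem_span_range_of_sum_mul_eq_zero (hCM : IsCohenMacaulayLocal R) {d : ℕ}
    (hd : ringKrullDim R = d) (v : Fin d → R) (hv : ∀ i, v i ∈ maximalIdeal R)
    (h : maximalIdeal R ≤ (Ideal.span (Set.range v)).radical) (r : Fin d → R)
    (hr : ∑ i, r i * v i = 0) (i : Fin d) : r i ∈ Ideal.span (Set.range v) := by
  obtain ⟨rs, -, hrs, hlen⟩ := hCM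
  have hlen' : rs.length = d := by
    rw [hd] at hlen
    exact_mod_cast hlen
  -- Any ordering of the parameters is regular, so `v i` may be put last: it is then regular modulo
  -- the others.
  set l := (Finset.univ.erase i).toList.map v with hl
  have hle : Ideal.ofList l ≤ Ideal.span (Set.range v) := by
    refine Ideal.span_mono fun x hx => ?_
    obtain ⟨j, -, rfl⟩ := List.mem_map.1 hx
    exact ⟨j, rfl⟩
  have hmem : ∀ j, j ≠ i → v j ∈ Ideal.ofList l := fun j hj =>
    Ideal.subset_span (List.mem_map.2 ⟨j, by simp [hj], rfl⟩)
  have hreg : IsRegular R (l ++ [v i]) := by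
    refine hrs.of_maximalIdeal_le_radical _ ?_ ?_ ?_
    · have : 0 < d := i.pos
      simp [hl, hlen']
      omega
    · intro x hx
      rcases List.mem_append.1 hx with hx | hx
      · obtain ⟨j, -, rfl⟩ := List.mem_map.1 hx
        exact hv j
      · rw [List.mem_singleton.1 hx]
        exact hv i
    · refine h.trans (Ideal.radical_mono (le_sup_of_le_right (Ideal.span_le.2 ?_)))
      rintro _ ⟨j, rfl⟩
      rw [Ideal.ofList_append, SetLike.mem_coe]
      by_cases hj : j = i
      · subst hj
        exact Ideal.mem_sup_right (by simp)
      · exact Ideal.mem_sup_left (hmem j hj)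
  have hi := (isWeaklyRegular_singleton_iff _ _).1
    ((isWeaklyRegular_append_iff R _ _).1 hreg.toIsWeaklyRegular).2
  have hsum : v i * r i ∈ Ideal.ofList l := by
    rw [← Finset.add_sum_erase _ _ (Finset.mem_univ i)] at hr
    rw [mul_comm, eq_neg_of_add_eq_zero_left hr, neg_mem_iff]
    exact Ideal.sum_mem _ fun j hj => Ideal.mul_mem_left _ _ (hmem j (Finset.ne_of_mem_erase hj))
  refine hle ?_
  have := mem_of_isSMulRegular_quotient_of_smul_mem hi (x := r i)
    (by simpa using hsum)
  simpa using this

end SystemsOfParameters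

/-! ### Length estimates for quotients by powers -/

section Length

theorem Module.length_le_add_of_exact {R N M P : Type*} [Ring R] [AddCommGroup N] [Module R N]
    [AddCommGroup M] [Module R M] [AddCommGroup P] [Module R P] {f : N →ₗ[R] M} {g : M →ₗ[R] P}
    (hg : Function.Surjective g) (h : Function.Exact f g) :
    Module.length R M ≤ Module.length R N + Module.length R P := by
  rw [Module.length_eq_add_of_exact (LinearMap.ker g).subtype g (Submodule.subtype_injective _) hg
    (LinearMap.exact_subtype_ker_map g)]
  gcongr
  rw [LinearMap.exact_iff.1 h]
  exact Module.length_le_of_surjective f.rangeRestrict f.surjective_rangeRestrict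

theorem Module.length_le_length_range {R N M P : Type*} [Ring R] [AddCommGroup N] [Module R N]
    [AddCommGroup M] [Module R M] [AddCommGroup P] [Module R P] (f : N →ₗ[R] M) {g : N →ₗ[R] P}
    (hg : Function.Surjective g) (h : LinearMap.ker f ≤ LinearMap.ker g) :
    Module.length R P ≤ Module.length R (LinearMap.range f) := by
  rw [← f.quotKerEquivRange.length_eq]
  refine Module.length_le_of_surjective ((LinearMap.ker f).liftQ g h) fun p => ?_
  obtain ⟨n, rfl⟩ := hg p
  exact ⟨Submodule.Quotient.mk n, by simp⟩

variable {R : Type*} [CommRing R]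

theorem Ideal.length_quotient_le_of_le {K L : Ideal R} (h : K ≤ L) :
    Module.length R (R ⧸ L) ≤ Module.length R (R ⧸ K) :=
  Module.length_le_of_surjective (Submodule.factor h) (Submodule.factor_surjective h)

/-- Multiplication by `x` gives the exact sequence `R/(K + y) → R/(K + xy) → R/(K + x) → 0`. -/
theorem Ideal.length_quotient_sup_span_mul_le (K : Ideal R) (x y : R) :
    Module.length R (R ⧸ (K ⊔ Ideal.span {x * y})) ≤
      Module.length R (R ⧸ (K ⊔ Ideal.span {x})) +
        Module.length R (R ⧸ (K ⊔ Ideal.span {y})) := by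
  have hle : K ⊔ Ideal.span {x * y} ≤ K ⊔ Ideal.span {x} :=
    sup_le_sup_left (Ideal.span_singleton_le_span_singleton.2 (dvd_mul_right x y)) _
  have hle' : K ⊔ Ideal.span {y} ≤
      Submodule.comap (LinearMap.mulLeft R x) (K ⊔ Ideal.span {x * y}) := by
    refine sup_le (fun z hz => Ideal.mem_sup_left (K.mul_mem_left x hz)) ?_
    rw [Ideal.span_singleton_le_iff_mem]
    exact Ideal.mem_sup_right (Ideal.mem_span_singleton_self _)
  rw [add_comm]
  refine Module.length_le_add_of_exact (f := Submodule.mapQ _ _ _ hle')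
    (Submodule.factor_surjective hle) fun z => ?_
  obtain ⟨z, rfl⟩ := Submodule.Quotient.mk_surjective _ z
  constructor
  · intro hz
    have hz' : z ∈ K ⊔ Ideal.span {x} := (Submodule.Quotient.mk_eq_zero _).1 hz
    obtain ⟨u, hu, w, hw, rfl⟩ := Submodule.mem_sup.1 hz'
    obtain ⟨t, rfl⟩ := Ideal.mem_span_singleton'.1 hw
    refine ⟨Submodule.Quotient.mk t, (Submodule.Quotient.eq _).2 ?_⟩
    refine Ideal.mem_sup_left ?_
    rw [LinearMap.mulLeft_apply]
    convert! K.neg_mem hu using 1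
    ring
  · rintro ⟨t, ht⟩
    obtain ⟨t, rfl⟩ := Submodule.Quotient.mk_surjective _ t
    rw [← ht]
    refine (Submodule.Quotient.mk_eq_zero _).2 (Ideal.mem_sup_right ?_)
    exact Ideal.mul_mem_right _ _ (Ideal.mem_span_singleton_self x)

theorem Ideal.length_quotient_sup_span_pow_le (K : Ideal R) (x : R) (n : ℕ) :
    Module.length R (R ⧸ (K ⊔ Ideal.span {x ^ n})) ≤
      n * Module.length R (R ⧸ (K ⊔ Ideal.span {x})) := by
  induction n with
  | zero =>
    have : Subsingleton (R ⧸ (K ⊔ Ideal.span {x ^ 0})) := by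
      rw [Ideal.Quotient.subsingleton_iff, pow_zero, Ideal.span_singleton_one, sup_top_eq]
    simp [Module.length_eq_zero]
  | succ n ih =>
    rw [pow_succ, Nat.cast_succ, add_mul, one_mul]
    exact (Ideal.length_quotient_sup_span_mul_le K _ _).trans (by gcongr)

theorem Ideal.length_quotient_ofList_pow_le (K : Ideal R) (l : List R) (n : ℕ) :
    Module.length R (R ⧸ (K ⊔ Ideal.ofList (l.map (· ^ n)))) ≤
      n ^ l.length * Module.length R (R ⧸ (K ⊔ Ideal.ofList l)) := by
  induction l generalizing K with
  | nil =>
    change Module.length R (R ⧸ (K ⊔ Ideal.ofList [])) ≤ _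
    simp
  | cons x l ih =>
    rw [List.map_cons, Ideal.ofList_cons, Ideal.ofList_cons, ← sup_assoc]
    refine (ih _).trans ?_
    have h := Ideal.length_quotient_sup_span_pow_le (K ⊔ Ideal.ofList l) x n
    rw [sup_right_comm K _ (Ideal.span {x ^ n}), sup_right_comm K _ (Ideal.span {x})] at h
    rw [List.length_cons, pow_succ, mul_assoc, ← sup_assoc]
    gcongr

end Length

/-! ### Growth of lengths and analytic dependence -/

section Counting

open IsLocalRing MvPolynomial

variable {R : Type*} [CommRing R] [IsLocalRing R]

theorem length_residueField : Module.length R (ResidueField R) = 1 := by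
  rw [Module.length_eq_of_surjective (R := ResidueField R) (S := R) residue_surjective]
  exact Module.length_eq_one _ _

/-- If the generators `v` of `H` are analytically independent, then `R / H ^ n` is at least as
long as the space of forms of degree less than `n` in as many variables. -/
theorem sum_card_le_length_quotient_pow {e : ℕ} {v : Fin e → R} {H : Ideal R}
    (hv : ∀ i, v i ∈ H) (hH : H ≤ maximalIdeal R)
    (hind : ∀ (n : ℕ) (P : MvPolynomial (Fin e) R), P.IsHomogeneous n →
      aeval v P ∈ maximalIdeal R * H ^ n → map (residue R) P = 0)
    (B : ℕ → Finset (Fin e →₀ ℕ)) (hB : ∀ n, ∀ α ∈ B n, α.degree = n) (n : ℕ) :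
    ((∑ j ∈ Finset.range n, (B j).card : ℕ) : ℕ∞) ≤ Module.length R (R ⧸ H ^ n) := by
  classical
  induction n with
  | zero => simp
  | succ n ih =>
    have hle : H ^ (n + 1) ≤ H ^ n := Ideal.pow_le_pow_right (Nat.le_succ n)
    set g : (R ⧸ H ^ (n + 1)) →ₗ[R] (R ⧸ H ^ n) := Submodule.factor hle
    let poly : (B n → R) → MvPolynomial (Fin e) R := fun c => ∑ α, monomial α.1 (c α)
    have hpoly : ∀ c, (poly c).IsHomogeneous n := fun c =>
      IsHomogeneous.sum _ _ _ fun α _ => isHomogeneous_monomial _ (hB n α.1 α.2)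
    have hval : ∀ c, aeval v (poly c) = ∑ α, c α * α.1.prod fun i k => v i ^ k := fun c => by
      simp [poly, aeval_monomial]
    have hcoeff : ∀ c (α : B n), (poly c).coeff α.1 = c α := fun c α => by
      rw [coeff_sum, Finset.sum_eq_single α, coeff_monomial, if_pos rfl]
      · intro β _ hβ
        rw [coeff_monomial, if_neg fun h => hβ (Subtype.ext h)]
      · simp
    let f : (B n → R) →ₗ[R] (R ⧸ H ^ (n + 1)) := (Submodule.mkQ (H ^ (n + 1))) ∘ₗ
      Fintype.linearCombination R fun α : B n => α.1.prod fun i k => v i ^ k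
    have hf : ∀ c, f c = Submodule.Quotient.mk (aeval v (poly c)) := fun c => by
      rw [hval]
      rfl
    have hmono : ∀ α : Fin e →₀ ℕ, (α.prod fun i k => v i ^ k) ∈ H ^ α.degree := fun α => by
      rw [Finsupp.prod, Finsupp.degree_apply, ← Finset.prod_pow_eq_pow_sum]
      exact Ideal.prod_mem_prod fun i _ => Ideal.pow_mem_pow (hv i) _
    have hfg : LinearMap.range f ≤ LinearMap.ker g := by
      rintro _ ⟨c, rfl⟩
      rw [LinearMap.mem_ker, hf]
      refine (Submodule.Quotient.mk_eq_zero _).2 ?_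
      rw [hval]
      refine Ideal.sum_mem _ fun α _ => Ideal.mul_mem_left _ _ ?_
      have := hmono α.1
      rwa [hB n _ α.2] at this
    let q : (B n → R) →ₗ[R] (B n → ResidueField R) :=
      (Algebra.linearMap R (ResidueField R)).compLeft _
    have hq : Function.Surjective q := fun y => by
      choose c hc using fun α => residue_surjective (y α)
      exact ⟨c, funext hc⟩
    -- A form of degree `n` whose value lies in `H ^ (n + 1) ≤ 𝔪 * H ^ n` has all coefficients in
    -- `𝔪`, so the span of the monomials surjects onto a residue-field space with one coordinate per
    -- monomial.
    have hker : LinearMap.ker f ≤ LinearMap.ker q := by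
      intro c hc
      rw [LinearMap.mem_ker, hf] at hc
      have hc' : aeval v (poly c) ∈ H ^ (n + 1) := (Submodule.Quotient.mk_eq_zero _).1 hc
      have h0 := hind n (poly c) (hpoly c) (by
        rw [pow_succ'] at hc'
        exact Ideal.mul_mono_left hH hc')
      refine funext fun α => ?_
      have := congrArg (coeff α.1) h0
      rwa [coeff_map, hcoeff, coeff_zero] at this
    have h1 := Module.length_le_length_range f hq hker
    rw [Module.length_pi_of_fintype] at h1
    simp only [length_residueField, Finset.sum_const, Finset.card_univ, Fintype.card_coe,
      nsmul_eq_mul, mul_one] at h1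
    rw [Finset.sum_range_succ, Nat.cast_add, add_comm,
      Module.length_eq_add_of_exact (LinearMap.ker g).subtype g (Submodule.subtype_injective _)
        (Submodule.factor_surjective hle) (LinearMap.exact_subtype_ker_map g)]
    gcongr
    exact h1.trans (Module.length_le_of_injective (Submodule.inclusion hfg)
      (Submodule.inclusion_injective hfg))

/-- Count the monomials with all exponents below `N`: there are `N ^ e` of them, of degree at most
`e * N`. -/
theorem pow_le_length_quotient_pow {e : ℕ} {v : Fin e → R} {H : Ideal R}
    (hv : ∀ i, v i ∈ H) (hH : H ≤ maximalIdeal R)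
    (hind : ∀ (n : ℕ) (P : MvPolynomial (Fin e) R), P.IsHomogeneous n →
      aeval v P ∈ maximalIdeal R * H ^ n → map (residue R) P = 0) (N : ℕ) :
    ((N ^ e : ℕ) : ℕ∞) ≤ Module.length R (R ⧸ H ^ (e * N + 1)) := by
  classical
  let A : Finset (Fin e →₀ ℕ) := Finset.finsupp Finset.univ fun _ => Finset.range N
  have hA : A.card = N ^ e := by simp [A, Finset.card_finsupp]
  have := sum_card_le_length_quotient_pow hv hH hind (fun n => A.filter fun α => α.degree = n)
    (fun n α hα => (Finset.mem_filter.1 hα).2) (e * N + 1)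
  rwa [← Finset.card_eq_sum_card_fiberwise, hA] at this
  intro α hα
  have hα' : α ∈ A := hα
  have h1 : ∀ i, α i < N := fun i => by
    simpa using (Finset.mem_finsupp_iff.1 hα').2 i (Finset.mem_univ i)
  rw [Finset.coe_range, Set.mem_Iio, Nat.lt_succ_iff, Finsupp.degree_eq_sum]
  refine (Finset.sum_le_card_nsmul _ _ N fun i _ => (h1 i).le).trans (by simp)

variable [IsNoetherianRing R]

/-- The `c * n`-th powers of a system of `d` parameters lie in `H ^ n`, and killing them gives
length at most `(c * n) ^ d` times a constant. -/
theorem exists_length_quotient_pow_le {d : ℕ} (hd : ringKrullDim R = d) {H : Ideal R} {c : ℕ}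
    (hc : maximalIdeal R ^ c ≤ H) :
    ∃ C : ℕ, ∀ n, Module.length R (R ⧸ H ^ n) ≤ ((C * (c * n) ^ d : ℕ) : ℕ∞) := by
  classical
  obtain ⟨S, hS, hcard⟩ :=
    Ideal.exists_finset_card_eq_height_of_isNoetherianRing (maximalIdeal R)
  have hlen : S.toList.length = d := by
    rw [← maximalIdeal_height_eq_ringKrullDim, ← hcard] at hd
    rw [Finset.length_toList]
    exact_mod_cast hd
  have hspan : Ideal.ofList S.toList = Ideal.span (S : Set R) := by
    simp [Ideal.ofList]
  have hSm : Ideal.span (S : Set R) ≤ maximalIdeal R := hS.1.2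
  have hart : IsArtinianRing (R ⧸ Ideal.span (S : Set R)) :=
    IsLocalRing.quotient_artinian_of_mem_minimalPrimes_of_isLocalRing _ hS
  have hfin : Module.length R (R ⧸ Ideal.span (S : Set R)) ≠ ⊤ := by
    rw [Module.length_eq_of_surjective (R := R ⧸ Ideal.span (S : Set R)) (S := R)
      Ideal.Quotient.mk_surjective]
    have : IsNoetherianRing (R ⧸ Ideal.span (S : Set R)) := inferInstance
    exact Module.length_ne_top
  obtain ⟨C, hC⟩ := ENat.ne_top_iff_exists.1 hfin
  refine ⟨C, fun n => ?_⟩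
  have hle : ⊥ ⊔ Ideal.ofList (S.toList.map (· ^ (c * n))) ≤ H ^ n := by
    rw [bot_sup_eq]
    refine Ideal.span_le.2 fun x hx => ?_
    obtain ⟨y, hy, rfl⟩ := List.mem_map.1 hx
    rw [SetLike.mem_coe]
    refine Ideal.pow_right_mono hc n ?_
    rw [← pow_mul]
    exact Ideal.pow_mem_pow (hSm (Ideal.subset_span (by simpa using hy))) _
  refine (Ideal.length_quotient_le_of_le hle).trans
    ((Ideal.length_quotient_ofList_pow_le _ _ _).trans ?_)
  rw [bot_sup_eq, hspan, hlen, ← hC]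
  push_cast
  rw [mul_comm]

/-- More than `dim R` generators of an ideal primary to the maximal ideal are analytically
dependent. -/
theorem exists_isHomogeneous_aeval_mem {d e : ℕ} (hd : ringKrullDim R = d) (hde : d < e)
    {v : Fin e → R} {H : Ideal R} (hv : ∀ i, v i ∈ H) (hH : H ≤ maximalIdeal R) {c : ℕ}
    (hc : maximalIdeal R ^ c ≤ H) :
    ∃ (n : ℕ) (P : MvPolynomial (Fin e) R), P.IsHomogeneous n ∧
      aeval v P ∈ maximalIdeal R * H ^ n ∧ map (residue R) P ≠ 0 := by
  by_contra! hind
  obtain ⟨C, hC⟩ := exists_length_quotient_pow_le hd hc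
  -- Since `e * N + 1 ≤ (e + 1) * N`, the upper bound is at most `(N - 1) * N ^ d`, which is less
  -- than `N ^ (d + 1) ≤ N ^ e`.
  set N := C * (c * (e + 1)) ^ d + 1 with hN
  have h1 : N ^ e ≤ C * (c * (e * N + 1)) ^ d := by
    exact_mod_cast (pow_le_length_quotient_pow hv hH hind N).trans (hC _)
  have hN1 : 1 ≤ N := Nat.succ_pos _
  have h2 : N ^ (d + 1) ≤ N ^ e := Nat.pow_le_pow_right hN1 hde
  have h3 : C * (c * (e * N + 1)) ^ d ≤ C * (c * (e + 1)) ^ d * N ^ d := by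
    rw [mul_assoc, ← mul_pow, mul_assoc c]
    gcongr
    rw [add_mul, one_mul]
    gcongr
  have h4 := h2.trans (h1.trans h3)
  rw [pow_succ, mul_comm] at h4
  have := Nat.le_of_mul_le_mul_right h4 (pow_pos hN1 d)
  omega

end Counting

/-! ### Reductions and their numbers of generators -/

section Reductions

open IsLocalRing

namespace Ideal

theorem IsPrimaryToMaximal.le_maximalIdeal {R : Type*} [CommRing R] [IsLocalRing R] {I : Ideal R}
    (hI : I.IsPrimaryToMaximal) : I ≤ maximalIdeal R :=
  hI.2 ▸ le_radical

theorem IsPrimaryToMaximal.exists_pow_le {R : Type*} [CommRing R] [IsLocalRing R]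
    [IsNoetherianRing R] {I : Ideal R} (hI : I.IsPrimaryToMaximal) :
    ∃ N, maximalIdeal R ^ N ≤ I :=
  hI.2 ▸ I.exists_radical_pow_le_of_fg (IsNoetherian.noetherian _)

theorem IsReductionOf.radical_le {R : Type*} [CommRing R] {L I : Ideal R}
    (hL : L.IsReductionOf I) : I.radical ≤ L.radical := by
  obtain ⟨-, r, hr⟩ := hL
  rw [radical_le_radical_iff]
  intro x hx
  have hx' := pow_mem_pow hx (r + 1)
  rw [hr] at hx'
  exact ⟨r + 1, mul_le_left hx'⟩

theorem IsReductionOf.pow_mul_pow {R : Type*} [CommRing R] {H I : Ideal R} {r : ℕ}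
    (h : I ^ (r + 1) = H * I ^ r) (n : ℕ) : I ^ (n + r) = H ^ n * I ^ r := by
  induction n with
  | zero => simp
  | succ n ih =>
    rw [show n + 1 + r = n + (r + 1) by ring, pow_add, h, mul_left_comm, ← pow_add, ih, pow_succ']
    ring

theorem IsReductionOf.trans {R : Type*} [CommRing R] {L H I : Ideal R}
    (hLH : L.IsReductionOf H) (hHI : H.IsReductionOf I) : L.IsReductionOf I := by
  obtain ⟨hLH', n, hn⟩ := hLH
  obtain ⟨hHI', r, hr⟩ := hHI
  refine ⟨hLH'.trans hHI', n + r, ?_⟩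
  rw [show n + r + 1 = n + 1 + r by ring, IsReductionOf.pow_mul_pow hr, hn, mul_assoc,
    ← IsReductionOf.pow_mul_pow hr]

variable {R : Type*} [CommRing R] [IsLocalRing R] [IsNoetherianRing R]

theorem isReductionOf_of_pow_le {L I : Ideal R} (hLI : L ≤ I) {r : ℕ}
    (h : I ^ (r + 1) ≤ L * I ^ r ⊔ maximalIdeal R * I ^ (r + 1)) : L.IsReductionOf I := by
  refine ⟨hLI, r, le_antisymm ?_ ?_⟩
  · exact Submodule.le_of_le_smul_of_le_jacobson_bot (IsNoetherian.noetherian _)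
      (maximalIdeal_le_jacobson _) h
  · rw [pow_succ']
    exact mul_mono_left hLI

/-- The radical of a reduction contains that of `I`, so Krull's height theorem applies to its
generators. -/
theorem IsReductionOf.le_of_span_range {I : Ideal R} (hI : maximalIdeal R ≤ I.radical)
    (hI' : I ≤ maximalIdeal R) {d e : ℕ} (hd : ringKrullDim R = d) {v : Fin e → R}
    (hv : (span (Set.range v)).IsReductionOf I) : d ≤ e := by
  have h := ringKrullDim_le_length_of_maximalIdeal_le_radical (List.ofFn v)
    (fun x hx => hI' (hv.1 (subset_span (by simpa [List.mem_ofFn] using hx))))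
    (by
      have : Ideal.ofList (List.ofFn v) = span (Set.range v) := by
        simp [Ideal.ofList, List.mem_ofFn, Set.range]
      rw [this]
      exact hI.trans hv.radical_le)
  rw [hd, List.length_ofFn] at h
  exact_mod_cast h

/-- A subideal `L` of an ideal `J` with `d` generators is generated modulo `𝔪 J` by fewer than
`d` elements unless it equals `J`. -/
theorem le_or_exists_le_span_range_sup {d : ℕ} (x : Fin d → R) {L : Ideal R}
    (hL : L ≤ span (Set.range x)) :
    span (Set.range x) ≤ L ∨ ∃ e < d, ∃ l : Fin e → R, (∀ i, l i ∈ L) ∧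
      L ≤ span (Set.range l) ⊔ maximalIdeal R * span (Set.range x) := by
  set J := span (Set.range x) with hJ
  have hx : ∀ i, x i ∈ J := fun i => subset_span ⟨i, rfl⟩
  have hmJ : ∀ ρ : Fin d → R, (∀ i, residue R (ρ i) = 0) →
      ∑ i, ρ i * x i ∈ maximalIdeal R * J := fun ρ hρ =>
    sum_mem _ fun i _ => mul_mem_mul ((residue_eq_zero_iff _).1 (hρ i)) (hx i)
  -- The residues of all coefficient vectors of elements of `L`. If `T` is everything, Nakayama
  -- gives `J ≤ L`; otherwise lifting a basis of `T` gives fewer than `d` generators modulo `𝔪 J`.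
  let T : Submodule (IsLocalRing.ResidueField R) (Fin d → IsLocalRing.ResidueField R) :=
    { carrier := {t | ∃ ρ : Fin d → R, (∀ i, residue R (ρ i) = t i) ∧ ∑ i, ρ i * x i ∈ L}
      zero_mem' := ⟨0, by simp, by simp⟩
      add_mem' := by
        rintro t t' ⟨ρ, hρ, h⟩ ⟨ρ', hρ', h'⟩
        refine ⟨ρ + ρ', fun i => by simp [hρ, hρ'], ?_⟩
        simpa [add_mul, Finset.sum_add_distrib] using L.add_mem h h'
      smul_mem' := by
        rintro c t ⟨ρ, hρ, h⟩
        obtain ⟨c, rfl⟩ := residue_surjective c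
        refine ⟨c • ρ, fun i => by simp [hρ], ?_⟩
        simpa [mul_assoc, ← Finset.mul_sum] using L.mul_mem_left c h }
  have hT : ∀ t, t ∈ T ↔
      ∃ ρ : Fin d → R, (∀ i, residue R (ρ i) = t i) ∧ ∑ i, ρ i * x i ∈ L := fun t => Iff.rfl
  by_cases htop : T = ⊤
  · left
    refine Submodule.le_of_le_smul_of_le_jacobson_bot (IsNoetherian.noetherian _)
      (maximalIdeal_le_jacobson _) (I := maximalIdeal R) ?_
    refine span_le.2 ?_
    rintro _ ⟨i, rfl⟩
    obtain ⟨ρ, hρ, h⟩ := (hT (Pi.single i 1)).1 (htop ▸ Submodule.mem_top)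
    have h1 := hmJ (Pi.single i 1 - ρ) fun j => by
      rw [Pi.sub_apply, map_sub, hρ, Pi.single_apply, Pi.single_apply]
      split_ifs <;> simp
    have := Submodule.add_mem_sup h h1
    rw [← Finset.sum_add_distrib] at this
    convert! this using 1
    simp [sub_mul, Pi.single_apply]
  · right
    have hlt : Module.finrank (IsLocalRing.ResidueField R) T < d := by
      simpa using Submodule.finrank_lt htop
    let b := Module.finBasis (IsLocalRing.ResidueField R) T
    choose ρ hρ hρL using fun j => (hT (b j)).1 (b j).2
    refine ⟨_, hlt, fun j => ∑ i, ρ j i * x i, hρL, fun y hy => ?_⟩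
    obtain ⟨η, hη⟩ := (Submodule.mem_span_range_iff_exists_fun R).1 (hL hy)
    simp only [smul_eq_mul] at hη
    have hmem : (fun i => residue R (η i)) ∈ T := ⟨η, fun _ => rfl, hη ▸ hy⟩
    choose c hc using fun j => residue_surjective (b.repr ⟨_, hmem⟩ j)
    have hsum : ∀ i, residue R (η i) = ∑ j, residue R (c j) * residue R (ρ j i) := fun i => by
      have h1 := congrArg Subtype.val (b.sum_repr ⟨_, hmem⟩)
      have h2 := congrFun h1 i
      simp only [Submodule.coe_sum, Submodule.coe_smul, Finset.sum_apply, Pi.smul_apply,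
        smul_eq_mul] at h2
      rw [← h2]
      exact Finset.sum_congr rfl fun j _ => by rw [hc, hρ]
    have h1 := hmJ (fun i => η i - ∑ j, c j * ρ j i) fun i => by
      rw [map_sub, hsum, map_sum]
      simp
    have h2 : ∑ j, c j * ∑ i, ρ j i * x i ∈ span (Set.range fun j => ∑ i, ρ j i * x i) :=
      sum_mem _ fun j _ => mul_mem_left _ _ (subset_span ⟨j, rfl⟩)
    have := Submodule.add_mem_sup h2 h1
    convert! this using 1
    simp only [sub_mul, Finset.sum_sub_distrib, hη, Finset.mul_sum, Finset.sum_mul, mul_assoc]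
    rw [Finset.sum_comm]
    ring

/-- A reduction with `dim R` generators is minimal. -/
theorem IsReductionOf.isMinimalReductionOf {I : Ideal R} (hI : maximalIdeal R ≤ I.radical)
    (hI' : I ≤ maximalIdeal R) {d : ℕ} (hd : ringKrullDim R = d) {x : Fin d → R}
    (hx : (span (Set.range x)).IsReductionOf I) :
    (span (Set.range x)).IsMinimalReductionOf I := by
  refine ⟨hx, fun L hL hLJ => ?_⟩
  rcases le_or_exists_le_span_range_sup x hLJ with h | ⟨e, he, l, hl, hle⟩
  · exact h
  · exfalso
    have hspan : span (Set.range l) ≤ L := span_le.2 (by rintro _ ⟨i, rfl⟩; exact hl i)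
    obtain ⟨hLI, r, hr⟩ := hL
    -- The error term `𝔪 J` is absorbed by Nakayama, so fewer than `dim R` elements would generate a
    -- reduction.
    have hred : (span (Set.range l)).IsReductionOf I := by
      refine isReductionOf_of_pow_le (hspan.trans hLI) (r := r) ?_
      calc I ^ (r + 1) = L * I ^ r := hr
        _ ≤ (span (Set.range l) ⊔ maximalIdeal R * I) * I ^ r :=
          mul_mono_left (hle.trans (sup_le_sup_left (mul_mono_right hx.1) _))
        _ = _ := by rw [sup_mul, mul_assoc, ← pow_succ']
    exact absurd (hred.le_of_span_range hI hI' hd) (by omega)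

end Ideal

end Reductions

/-! ### Eliminating a generator from an analytically dependent system -/

section Elimination

open IsLocalRing MvPolynomial

variable {R : Type*} [CommRing R]

/-- Telescoping the difference of monomials spends one factor of `H` on `L`; the extra factor `z`
restores the exponent to the full degree. -/
theorem mul_prod_pow_sub_mem {e : ℕ} {v w : Fin e → R} {H L : Ideal R} (hv : ∀ i, v i ∈ H)
    (hw : ∀ i, w i ∈ H) (hvw : ∀ i, v i - w i ∈ L) (α : Fin e →₀ ℕ) {z : R} (hz : z ∈ H) :
    z * ((α.prod fun i k => v i ^ k) - α.prod fun i k => w i ^ k) ∈ L * H ^ α.degree := by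
  classical
  have hmono : ∀ β : Fin e →₀ ℕ, (β.prod fun i k => v i ^ k) ∈ H ^ β.degree := fun β => by
    rw [Finsupp.prod, Finsupp.degree_apply, ← Finset.prod_pow_eq_pow_sum]
    exact Ideal.prod_mem_prod fun i _ => Ideal.pow_mem_pow (hv i) _
  obtain ⟨n, hn⟩ : ∃ n, α.degree = n := ⟨_, rfl⟩
  induction n generalizing α with
  | zero =>
    rw [Finsupp.degree_eq_zero_iff] at hn
    simp [hn]
  | succ n ih =>
    obtain ⟨i, hi⟩ : ∃ i, α i ≠ 0 := by
      by_contra! h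
      rw [show α = 0 from Finsupp.ext h] at hn
      simp at hn
    obtain ⟨β, rfl⟩ : ∃ β, α = β + Finsupp.single i 1 :=
      ⟨α - Finsupp.single i 1, (tsub_add_cancel_of_le (by
        rw [Finsupp.single_le_iff]; exact Nat.one_le_iff_ne_zero.2 hi)).symm⟩
    have hβ : β.degree = n := by
      simpa [map_add, Finsupp.degree_single] using hn
    have hprod : ∀ u : Fin e → R, ((β + Finsupp.single i 1).prod fun i k => u i ^ k) =
        (β.prod fun i k => u i ^ k) * u i := fun u => by
      rw [Finsupp.prod_add_index' (by simp) (by simp [pow_add])]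
      simp
    rw [hprod, hprod, hn]
    have h1 : (v i - w i) * ((β.prod fun i k => v i ^ k) * z) ∈ L * H ^ (n + 1) := by
      rw [pow_succ]
      exact Ideal.mul_mem_mul (hvw i) (Ideal.mul_mem_mul (hβ ▸ hmono β) hz)
    have h2 : z * ((β.prod fun i k => v i ^ k) - β.prod fun i k => w i ^ k) * w i ∈
        L * H ^ (n + 1) := by
      rw [pow_succ, ← mul_assoc]
      exact Ideal.mul_mem_mul (hβ ▸ ih β hβ) (hw i)
    have := Ideal.add_mem _ h1 h2
    convert! this using 1
    ring

theorem mul_aeval_sub_mem {e n : ℕ} {v γ : Fin e → R} {t : R} {H L : Ideal R}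
    (hv : ∀ i, v i ∈ H) (ht : t ∈ H) (hvt : ∀ i, v i - γ i * t ∈ L)
    {P : MvPolynomial (Fin e) R} (hP : P.IsHomogeneous n) {z : R} (hz : z ∈ H) :
    z * (aeval v P - eval γ P * t ^ n) ∈ L * H ^ n := by
  have hsum : z * (aeval v P - eval γ P * t ^ n) = ∑ α ∈ P.support, P.coeff α *
      (z * ((α.prod fun i k => v i ^ k) - α.prod fun i k => (γ i * t) ^ k)) := by
    have h1 : aeval v P = ∑ α ∈ P.support, P.coeff α * α.prod fun i k => v i ^ k := by
      rw [aeval_def, eval₂_eq]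
      rfl
    have h2 : eval γ P * t ^ n =
        ∑ α ∈ P.support, P.coeff α * α.prod fun i k => (γ i * t) ^ k := by
      rw [eval_eq, Finset.sum_mul]
      refine Finset.sum_congr rfl fun α hα => ?_
      have hdeg : α.degree = n := by
        rw [Finsupp.degree_eq_weight_one]
        exact hP (mem_support_iff.1 hα)
      rw [Finsupp.prod, mul_assoc, ← hdeg, Finsupp.degree_apply, ← Finset.prod_pow_eq_pow_sum,
        ← Finset.prod_mul_distrib]
      exact congrArg _ (Finset.prod_congr rfl fun i _ => (mul_pow _ _ _).symm)
    rw [h1, h2, ← Finset.sum_sub_distrib, Finset.mul_sum]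
    exact Finset.sum_congr rfl fun α _ => by ring
  rw [hsum]
  refine Ideal.sum_mem _ fun α hα => Ideal.mul_mem_left _ _ ?_
  have hdeg : α.degree = n := by
    rw [Finsupp.degree_eq_weight_one]
    exact hP (mem_support_iff.1 hα)
  have := mul_prod_pow_sub_mem hv (fun i => H.mul_mem_left (γ i) ht) hvt α hz
  rwa [hdeg] at this

theorem pow_succ_le_mul_pow_sup {H L : Ideal R} {t : R} (ht : t ∈ H)
    (h : H ≤ L ⊔ Ideal.span {t}) (n : ℕ) :
    H ^ (n + 1) ≤ L * H ^ n ⊔ Ideal.span {t ^ (n + 1)} := by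
  induction n with
  | zero => simpa using h
  | succ n ih =>
    have hsp : Ideal.span {t ^ (n + 1)} ≤ H ^ (n + 1) :=
      (Ideal.span_singleton_le_iff_mem _).2 (Ideal.pow_mem_pow ht _)
    calc H ^ (n + 1 + 1) = H ^ (n + 1) * H := pow_succ _ _
      _ ≤ (L * H ^ n ⊔ Ideal.span {t ^ (n + 1)}) * H := Ideal.mul_mono_left ih
      _ = L * H ^ (n + 1) ⊔ Ideal.span {t ^ (n + 1)} * H := by
        rw [Ideal.sup_mul, mul_assoc, ← pow_succ]
      _ ≤ L * H ^ (n + 1) ⊔ Ideal.span {t ^ (n + 1)} * (L ⊔ Ideal.span {t}) :=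
        sup_le_sup_left (Ideal.mul_mono_right h) _
      _ ≤ _ := by
        rw [Ideal.mul_sup, Ideal.span_singleton_mul_span_singleton, ← pow_succ]
        refine sup_le le_sup_left (sup_le (le_sup_of_le_left ?_) le_sup_right)
        rw [mul_comm]
        exact Ideal.mul_mono_right hsp

variable [IsLocalRing R] [IsNoetherianRing R] [Infinite (IsLocalRing.ResidueField R)]

/-- An ideal with `e + 1` analytically dependent generators has a reduction with `e`
generators. -/
theorem exists_span_range_isReductionOf {e n : ℕ} {v : Fin (e + 1) → R}
    {P : MvPolynomial (Fin (e + 1)) R} (hP : P.IsHomogeneous n)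
    (hPv : aeval v P ∈ maximalIdeal R * Ideal.span (Set.range v) ^ n)
    (hP0 : map (residue R) P ≠ 0) :
    ∃ u : Fin e → R, (Ideal.span (Set.range u)).IsReductionOf (Ideal.span (Set.range v)) := by
  set H := Ideal.span (Set.range v) with hH
  have hv : ∀ i, v i ∈ H := fun i => Ideal.subset_span ⟨i, rfl⟩
  -- The factor `X 0` makes `γ 0` a unit as well, so that `t = v 0 / γ 0` makes `v 0 - γ 0 * t`
  -- vanish and only `e` generators remain.
  obtain ⟨c, hc⟩ : ∃ c, eval c (map (residue R) P * X 0) ≠ 0 := by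
    by_contra! h
    exact mul_ne_zero hP0 (X_ne_zero 0) (MvPolynomial.funext fun c => by rw [h, map_zero])
  rw [map_mul, eval_X] at hc
  choose γ hγ using fun i => residue_surjective (c i)
  obtain rfl : (fun i => residue R (γ i)) = c := funext hγ
  have hunit : IsUnit (eval γ P) :=
    isUnit_eval_of_eval_map_residue_ne_zero (left_ne_zero_of_mul hc)
  obtain ⟨g, hg⟩ := ((residue_ne_zero_iff_isUnit _).1 (right_ne_zero_of_mul hc)).exists_right_inv
  set t := g * v 0 with ht_def
  have ht : t ∈ H := H.mul_mem_left _ (hv 0)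
  let u : Fin e → R := fun i => v i.succ - γ i.succ * t
  set L := Ideal.span (Set.range u) with hLdef
  have hLH : L ≤ H := Ideal.span_le.2 (by
    rintro _ ⟨i, rfl⟩
    exact H.sub_mem (hv _) (H.mul_mem_left _ ht))
  have hvt : ∀ i, v i - γ i * t ∈ L := by
    refine Fin.cases ?_ fun i => Ideal.subset_span ⟨i, rfl⟩
    rw [ht_def, ← mul_assoc, hg, one_mul, sub_self]
    exact L.zero_mem
  have hsup : H ≤ L ⊔ Ideal.span {t} := Ideal.span_le.2 (by
    rintro _ ⟨i, rfl⟩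
    have := Submodule.add_mem_sup (hvt i) 
      ((Ideal.span {t}).mul_mem_left (γ i) (Ideal.mem_span_singleton_self t))
    rwa [sub_add_cancel] at this)
  refine ⟨u, Ideal.isReductionOf_of_pow_le hLH (r := n) ?_⟩
  refine (pow_succ_le_mul_pow_sup ht hsup n).trans (sup_le le_sup_left ?_)
  rw [Ideal.span_singleton_le_iff_mem]
  -- Modulo `L * H ^ n`, the element `eval γ P * t ^ (n + 1)` equals `aeval v P * t`, which lies in
  -- `𝔪 * H ^ (n + 1)`.
  refine (Ideal.unit_mul_mem_iff_mem _ hunit).1 ?_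
  have h1 := mul_aeval_sub_mem hv ht hvt hP ht
  have h2 : aeval v P * t ∈ maximalIdeal R * H ^ (n + 1) := by
    rw [pow_succ, ← mul_assoc]
    exact Ideal.mul_mem_mul hPv ht
  have := Submodule.add_mem_sup (Ideal.mul_mem_left _ (-1) h1) h2
  convert! this using 1
  ring

/-- Minimal reductions of an ideal primary to the maximal ideal have `dim R` generators. -/
theorem Ideal.IsMinimalReductionOf.exists_span_range_eq {d : ℕ} (hd : ringKrullDim R = d)
    {I H : Ideal R} (hI : maximalIdeal R ≤ I.radical) (hI' : I ≤ maximalIdeal R)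
    (hH : H.IsMinimalReductionOf I) : ∃ v : Fin d → R, Ideal.span (Set.range v) = H := by
  classical
  have hex : ∃ e, ∃ v : Fin e → R, Ideal.span (Set.range v) = H := by
    obtain ⟨S, hS⟩ := IsNoetherian.noetherian H
    exact ⟨S.card, fun i => (S.equivFin.symm i : R), by
      rw [← hS]
      congr 1
      ext y
      constructor
      · rintro ⟨i, rfl⟩
        exact (S.equivFin.symm i).2
      · exact fun hy => ⟨S.equivFin ⟨y, hy⟩, by simp⟩⟩
  obtain ⟨v, hv⟩ := Nat.find_spec hex
  have hmin := fun m => Nat.find_min (H := hex) (m := m)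
  generalize Nat.find hex = e at v hmin
  have hde : d ≤ e := Ideal.IsReductionOf.le_of_span_range hI hI' hd (hv ▸ hH.1)
  rcases hde.eq_or_lt with rfl | hlt
  · exact ⟨v, hv⟩
  -- With `e > d` the least number of generators, elimination gives a reduction of `H` inside `H`;
  -- by minimality it equals `H`, which then has fewer than `e` generators.
  · exfalso
    obtain ⟨e, rfl⟩ : ∃ e', e = e' + 1 := ⟨e - 1, by omega⟩
    obtain ⟨c, hc⟩ := H.exists_radical_pow_le_of_fg (IsNoetherian.noetherian _)
    obtain ⟨n, P, hP, hPv, hP0⟩ := exists_isHomogeneous_aeval_mem hd hlt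
      (fun i => hv ▸ Ideal.subset_span ⟨i, rfl⟩) (hH.1.1.trans hI')
      ((Ideal.pow_right_mono (hI.trans hH.1.radical_le) c).trans hc) (v := v)
    subst hv
    obtain ⟨u, hu⟩ := exists_span_range_isReductionOf hP hPv hP0
    exact hmin e (Nat.lt_succ_self e) ⟨u, le_antisymm hu.1 (hH.2 (hu.trans hH.1) hu.1)⟩

end Elimination

/-! ### Ideal-theoretic form of the stretched condition -/

section Stretched

open IsLocalRing

theorem length_quotient_submoduleOf_le_one_iff {S : Type*} [CommRing S] [IsLocalRing S]
    {A B : Ideal S} : Module.length S (↥A ⧸ Submodule.submoduleOf B A) ≤ 1 ↔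
      (∃ w ∈ A, A ≤ Ideal.span {w} ⊔ B) ∧ ∀ u ∈ maximalIdeal S, ∀ x ∈ A, u * x ∈ B := by
  have hmk : ∀ x : A, (Submodule.Quotient.mk x : ↥A ⧸ Submodule.submoduleOf B A) = 0 ↔
      (x : S) ∈ B := fun x => by
    rw [Submodule.Quotient.mk_eq_zero]
    rfl
  constructor
  · intro h
    by_cases hsub : Subsingleton (↥A ⧸ Submodule.submoduleOf B A)
    · have hAB : ∀ x ∈ A, x ∈ B := fun x hx => (hmk ⟨x, hx⟩).1 (Subsingleton.elim _ _)
      exact ⟨⟨0, A.zero_mem, fun x hx => Ideal.mem_sup_right (hAB x hx)⟩,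
        fun u _ x hx => B.mul_mem_left _ (hAB x hx)⟩
    · have hsimple : IsSimpleModule S (↥A ⧸ Submodule.submoduleOf B A) := by
        rw [← Module.length_eq_one_iff]
        refine le_antisymm h (Order.one_le_iff_pos.2 (Module.length_pos_iff.2 ?_))
        exact not_subsingleton_iff_nontrivial.1 hsub
      have hmax : Module.annihilator S (↥A ⧸ Submodule.submoduleOf B A) = maximalIdeal S :=
        eq_maximalIdeal IsSimpleModule.annihilator_isMaximal
      have := hsimple.nontrivial
      obtain ⟨q, hq⟩ := exists_ne (0 : ↥A ⧸ Submodule.submoduleOf B A)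
      obtain ⟨w, rfl⟩ := Submodule.Quotient.mk_surjective _ q
      refine ⟨⟨w, w.2, fun x hx => ?_⟩, fun u hu x hx => ?_⟩
      · have htop := (IsSimpleModule.span_singleton_eq_top S hq)
        have hx' : (Submodule.Quotient.mk ⟨x, hx⟩ : ↥A ⧸ Submodule.submoduleOf B A) ∈
            Submodule.span S {Submodule.Quotient.mk w} := htop ▸ Submodule.mem_top
        obtain ⟨t, ht⟩ := Submodule.mem_span_singleton.1 hx'
        rw [← Submodule.Quotient.mk_smul, eq_comm, ← sub_eq_zero, ← Submodule.Quotient.mk_sub,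
          hmk] at ht
        have := Submodule.add_mem_sup (Ideal.mul_mem_left _ t (Ideal.mem_span_singleton_self
          (w : S))) ht
        simpa using this
      · rw [← hmax, Module.mem_annihilator] at hu
        have := hu (Submodule.Quotient.mk ⟨x, hx⟩)
        rw [← Submodule.Quotient.mk_smul, hmk] at this
        exact this
  · rintro ⟨⟨w, hw, hle⟩, hm⟩
    have hone : Module.length S (S ⧸ maximalIdeal S) = 1 := length_residueField
    rw [← hone]
    let f : S →ₗ[S] ↥A ⧸ Submodule.submoduleOf B A :=
      LinearMap.toSpanSingleton S _ (Submodule.Quotient.mk ⟨w, hw⟩)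
    have hker : maximalIdeal S ≤ LinearMap.ker f := fun u hu => by
      rw [LinearMap.mem_ker, LinearMap.toSpanSingleton_apply, ← Submodule.Quotient.mk_smul, hmk]
      exact hm u hu w hw
    refine Module.length_le_of_surjective
      ((maximalIdeal S).liftQ f hker) fun q => ?_
    obtain ⟨x, rfl⟩ := Submodule.Quotient.mk_surjective _ q
    obtain ⟨y, hy, b, hb, hyb⟩ := Submodule.mem_sup.1 (hle x.2)
    obtain ⟨t, rfl⟩ := Ideal.mem_span_singleton'.1 hy
    refine ⟨Submodule.Quotient.mk t, ?_⟩
    rw [Submodule.liftQ_apply, LinearMap.toSpanSingleton_apply, ← Submodule.Quotient.mk_smul,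
      eq_comm, ← sub_eq_zero, ← Submodule.Quotient.mk_sub, hmk]
    have : (x : S) - t * w = b := by rw [← hyb]; ring
    simpa [this] using hb

variable {R : Type*} [CommRing R]

/-- The component in `H` of an element of `L` lies in `H ⊓ I ^ 2`. Passing from `H` to `H * I`
matters for openness: perturbing the generators changes `H * I` only inside `I ^ 2`, as Nakayama for
`I ^ 2` requires. -/
theorem le_sup_mul_of_le_sup {I H K L : Ideal R} (hHI : H ⊓ I ^ 2 = H * I) (hK : K ≤ I ^ 2)
    (hL : L ≤ I ^ 2) (h : L ≤ K ⊔ H) : L ≤ K ⊔ H * I := by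
  intro x hx
  obtain ⟨y, hy, z, hz, rfl⟩ := Submodule.mem_sup.1 (h hx)
  have hz' : z ∈ I ^ 2 := (Submodule.add_mem_iff_right _ (hK hy)).1 (hL hx)
  exact Submodule.add_mem_sup hy (hHI ▸ ⟨hz, hz'⟩)

theorem mem_span_range_mul_iff {d : ℕ} {v : Fin d → R} {I : Ideal R} {x : R} :
    x ∈ Ideal.span (Set.range v) * I ↔ ∃ b : Fin d → R, (∀ i, b i ∈ I) ∧ ∑ i, b i * v i = x := by
  constructor
  · intro hx
    induction hx using Submodule.mul_induction_on' with
    | mem_mul_mem y hy z hz =>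
      obtain ⟨c, rfl⟩ := (Submodule.mem_span_range_iff_exists_fun R).1 hy
      refine ⟨fun i => c i * z, fun i => I.mul_mem_left _ hz, ?_⟩
      rw [Finset.sum_mul]
      exact Finset.sum_congr rfl fun i _ => by rw [smul_eq_mul]; ring
    | add y _ z _ hy hz =>
      obtain ⟨b, hb, rfl⟩ := hy
      obtain ⟨b', hb', rfl⟩ := hz
      refine ⟨b + b', fun i => I.add_mem (hb i) (hb' i), ?_⟩
      simp [add_mul, Finset.sum_add_distrib]
  · rintro ⟨b, hb, rfl⟩
    refine Ideal.sum_mem _ fun i _ => ?_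
    rw [mul_comm (b i)]
    exact Ideal.mul_mem_mul (Ideal.subset_span (Set.mem_range_self i)) (hb i)

variable [IsLocalRing R]

theorem hilbertFunction_map_mk_two_le_one_iff {I H : Ideal R} (hH : H ≤ maximalIdeal R) :
    (I.map (Ideal.Quotient.mk H)).hilbertFunction 2 ≤ 1 ↔
      (∃ w ∈ I ^ 2, I ^ 2 ≤ Ideal.span {w} ⊔ I ^ 3 ⊔ H) ∧
        maximalIdeal R * I ^ 2 ≤ I ^ 3 ⊔ H := by
  have : Nontrivial (R ⧸ H) :=
    Ideal.Quotient.nontrivial_iff.2 (ne_top_of_le_ne_top Ideal.IsPrime.ne_top' hH)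
  have : IsLocalRing (R ⧸ H) :=
    IsLocalRing.of_surjective' (Ideal.Quotient.mk H) Ideal.Quotient.mk_surjective
  have hmap : (maximalIdeal R).map (Ideal.Quotient.mk H) = maximalIdeal (R ⧸ H) :=
    IsLocalRing.map_maximalIdeal_of_surjective _ Ideal.Quotient.mk_surjective
  rw [Ideal.hilbertFunction, length_quotient_submoduleOf_le_one_iff, ← Ideal.map_pow,
    ← Ideal.map_pow]
  refine and_congr ⟨?_, ?_⟩ ⟨fun h => Ideal.mul_le.2 fun u hu x hx => ?_, fun h u hu x hx => ?_⟩
  · rintro ⟨w, hw, h⟩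
    obtain ⟨w, hwI, rfl⟩ :=
      (Ideal.mem_map_iff_of_surjective _ Ideal.Quotient.mk_surjective).1 hw
    refine ⟨w, hwI, fun x hx => ?_⟩
    have := h (Ideal.mem_map_of_mem _ hx)
    rwa [← Set.image_singleton, ← Ideal.map_span, ← Ideal.map_sup,
      Ideal.mem_quotient_iff_mem_sup] at this
  · rintro ⟨w, hw, h⟩
    refine ⟨_, Ideal.mem_map_of_mem _ hw, ?_⟩
    rw [← Set.image_singleton, ← Ideal.map_span, ← Ideal.map_sup]
    refine (Ideal.map_mono h).trans ?_
    rw [Ideal.map_sup _ (_ ⊔ _), Ideal.map_quotient_self, sup_bot_eq]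
  · have := h _ (hmap ▸ Ideal.mem_map_of_mem (Ideal.Quotient.mk H) hu) _
      (Ideal.mem_map_of_mem _ hx)
    rwa [← map_mul, Ideal.mem_quotient_iff_mem_sup] at this
  · rw [← hmap] at hu
    obtain ⟨u, hu', rfl⟩ := (Ideal.mem_map_iff_of_surjective _ Ideal.Quotient.mk_surjective).1 hu
    obtain ⟨x, hx', rfl⟩ := (Ideal.mem_map_iff_of_surjective _ Ideal.Quotient.mk_surjective).1 hx
    rw [← map_mul, Ideal.mem_quotient_iff_mem_sup]
    exact h (Ideal.mul_mem_mul hu' hx')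

end Stretched

/-! ### The main theorem -/

theorem mainTheorem11 {R : Type*} [CommRing R] [IsLocalRing R] [IsNoetherianRing R]
    [Infinite (IsLocalRing.ResidueField R)]
    (hequi : IsEquicharacteristic R) (hCM : IsCohenMacaulayLocal R)
    (d : ℕ) (hd : ringKrullDim R = d)
    (I : Ideal R) (hI : I.IsPrimaryToMaximal)
    (H : Ideal R) (hH : I.IsStretchedWith H)
    (s : ℕ) (a : Fin s → R) (ha : Ideal.span (Set.range a) = I) :
    ∃ U : Set (Fin d × Fin s → IsLocalRing.ResidueField R), IsZariskiDenseOpen U ∧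
      ∀ c : Fin d → Fin s → R,
        (fun p : Fin d × Fin s => IsLocalRing.residue R (c p.1 p.2)) ∈ U →
          I.IsStretchedWith (idealOfCombinations c a) := by
  have hIm := hI.le_maximalIdeal
  have hrad : IsLocalRing.maximalIdeal R ≤ I.radical := hI.2.ge
  obtain ⟨N, hN⟩ := hI.exists_pow_le
  obtain ⟨hHmin, hHinf, hHhilb⟩ := hH
  have hHI : H ≤ I := hHmin.1.1
  obtain ⟨v, hv⟩ := hHmin.exists_span_range_eq hd hrad hIm
  have hvH : ∀ i, v i ∈ H := fun i => hv ▸ Ideal.subset_span ⟨i, rfl⟩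
  -- The point of the family at which the ideal is `H`.
  choose c₀ hc₀ using fun i => (Submodule.mem_span_range_iff_exists_fun R).1 (ha ▸ hHI (hvH i))
  simp only [smul_eq_mul] at hc₀
  have hJ₀ : idealOfCombinations c₀ a = H := by
    rw [idealOfCombinations, ← hv]
    simp only [hc₀]
  obtain ⟨r, hr⟩ := hHmin.1.2
  obtain ⟨⟨w, hw, hwle⟩, hmle⟩ :=
    (hilbertFunction_map_mk_two_le_one_iff (hHI.trans hIm)).1 hHhilb
  have hI32 : I ^ 3 ≤ I ^ 2 := Ideal.pow_le_pow_right (by norm_num)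
  obtain ⟨f₁, hf₁, hred⟩ := exists_pow_succ_le_idealOfCombinations_mul_pow a c₀ r
    (by rw [ha, hJ₀, hr])
  obtain ⟨f₂, hf₂, hinj⟩ := exists_forall_sum_mul_mem_sq a c₀ (ha ▸ hN) (by
    intro ρ hρ i
    simp only [hc₀] at hρ
    rw [ha] at hρ ⊢
    -- Rewriting the sum with coefficients `b i ∈ I` makes `ρ - b` a relation among parameters, so
    -- `ρ i - b i ∈ H ≤ I`.
    have hmem : ∑ i, ρ i * v i ∈ Ideal.span (Set.range v) * I := by
      rw [hv, ← hHinf]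
      exact ⟨H.sum_mem fun i _ => H.mul_mem_left _ (hvH i), hρ⟩
    obtain ⟨b, hb, hsum⟩ := mem_span_range_mul_iff.1 hmem
    have := mem_span_range_of_sum_mul_eq_zero hCM hd v (fun i => hIm (hHI (hvH i)))
      (hrad.trans (hv ▸ hHmin.1.radical_le)) (fun i => ρ i - b i)
      (by simp only [sub_mul, Finset.sum_sub_distrib, hsum, sub_self]) i
    rw [hv] at this
    exact (Submodule.sub_mem_iff_left _ (hb i)).1 (hHI this))
  obtain ⟨f₃, hf₃, hstr⟩ := exists_sq_le_span_singleton_sup a c₀ (w := w) (ha ▸ hN) (ha ▸ hw)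
    (by
      rw [ha, hJ₀, ← sup_assoc]
      exact le_sup_mul_of_le_sup hHinf
        (sup_le ((Ideal.span_singleton_le_iff_mem _).2 hw) hI32) le_rfl hwle)
    (by
      rw [ha, hJ₀]
      exact le_sup_mul_of_le_sup hHinf hI32 Ideal.mul_le_right hmle)
  rw [ha] at hred hinj hstr
  refine ⟨_, isZariskiDenseOpen_setOf_eval_ne_zero (mul_ne_zero (mul_ne_zero hf₁ hf₂) hf₃),
    fun c hc => ?_⟩
  rw [Set.mem_ofPred_eq, map_mul, map_mul] at hc
  have hc₁ := hred c (left_ne_zero_of_mul (left_ne_zero_of_mul hc))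
  have hc₂ := hinj c (right_ne_zero_of_mul (left_ne_zero_of_mul hc))
  obtain ⟨hc₃, hc₄⟩ := hstr c (right_ne_zero_of_mul hc)
  have hJI : idealOfCombinations c a ≤ I := ha ▸ idealOfCombinations_le_span a c
  have hJred : (idealOfCombinations c a).IsReductionOf I :=
    Ideal.isReductionOf_of_pow_le hJI (r := r) (hc₁.trans le_sup_left)
  refine ⟨hJred.isMinimalReductionOf hrad hIm hd, le_antisymm ?_ ?_, ?_⟩
  · rintro x ⟨hxJ, hxI⟩
    obtain ⟨ρ, hρ⟩ := (Submodule.mem_span_range_iff_exists_fun R).1 hxJ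
    simp only [smul_eq_mul] at hρ
    exact mem_span_range_mul_iff.2 ⟨ρ, hc₂ ρ (by rw [hρ]; exact hxI), hρ⟩
  · exact le_inf Ideal.mul_le_left (by rw [sq]; exact Ideal.mul_mono_left hJI)
  · refine (hilbertFunction_map_mk_two_le_one_iff (hJI.trans hIm)).2 ⟨⟨w, hw, ?_⟩, ?_⟩
    · rw [sup_assoc]
      exact hc₃.trans (sup_le_sup_left (sup_le_sup_left Ideal.mul_le_left _) _)
    · exact hc₄.trans (sup_le_sup_left Ideal.mul_le_left _)
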